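/- **Definitions.** For an integer $n\ge 2$, an $n$-adic interval is an interval $[k/n^m,(k+1)/n^m)$ with $m,k\in\mathbb Z$; its $n$-adic children are its $n$ consecutive subintervals of length $n^{-m-1}$. A Borel measure $\mu$ on $\mathbb R$ is *$n$-adic doubling* if there is $C>0$ such that for every $n$-adic interval $I$ and any two children $I_i,I_j$ of $I$ the measures $\mu(I_i),\mu(I_j)$ are positive and finite and $1/C\le \mu(I_i)/\mu(I_j)\le C$. It is *doubling* on $X\subseteq\mathbb R$ if there is $C$ with $\mu(2I)\le C\mu(I)$ for every bounded half-open interval $I=[u,v)$, $u<v$, with $2I\subseteq X$, where $2I$ has the same midpoint as $I$ and twice its length. **The measures.** Let $q$ be a prime, let $0<a<1<b$ with $(q-1)a+b=q$, let $I$ be a $q$-adic interval and $\alpha\ge 1$ an integer. Let $Z$ be the left endpoint of the last child of $I$, and for $1\le t\le 2\alpha$ let $H^{(t)}=[Z-q^{-t}|I|,Z)$ and $G^{(t)}=[Z,Z+q^{-t}|I|)$, which are $q$-adic intervals. Starting with Lebesgue measure on $I$, redistribute the mass in $2\alpha$ steps. Step $1$ multiplies the mass of the last child of $I$ by $b$ and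 the mass of every other child by $a$. Step $t$, $2\le t\le 2\alpha$, does the following on $H^{(t-1)}$ and on $G^{(t-1)}$: it multiplies the mass of one child by $b$ and the mass of every other child by $a$, where the child with factor $b$ is the first one if $t\le\alpha$ and the last one if $t\ge\alpha+1$. Given pairwise disjoint $q$-adic intervals $I_\ell\subseteq[0,1)$ and integers $\alpha_\ell\ge1$ ($\ell\in\mathbb N$), let $\mu_{a,b}$ be the measure on $\mathbb R$ that arises in this way on every $I_\ell$, with $\alpha=\alpha_\ell$, and is Lebesgue measure off $\bigcup_\ell I_\ell$. **Theorem 1.1.** Let $p>q$ be primes. There are pairwise disjoint $q$-adic intervals $I_\ell\subseteq[0,1)$ and integers $\alpha_\ell\ge 1$ ($\ell\in\mathbb N$), taking each value only finitely often, such that the family of all measures $\mu_{a,b}$ with $0<a<1<b$ and $(q-1)a+b=q$ is infinite, and every measure $\mu$ in it satisfies $\mu([0,1))=1$, is both $p$-adic and $q$-adic doubling, and is not doubling, not even on $[0,1)$. In particular, for any two distinct primes there is an infinite family of measures on $[0,1)$ (the restrictions of the $\mu_{a,b}$, which all agree with Lebesgue measure off $[0,1)$), and likewise of measures on $\mathbb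 R$, that are adic doubling for both primes but not doubling. -/

import Mathlib

open MeasureTheory Set
open scoped NNReal ENNReal

/-- The `n`-adic interval `[k / n ^ m, (k + 1) / n ^ m)`, where `m` and `k` are integers. -/
def adicInterval (n : ℕ) (m k : ℤ) : Set ℝ :=
  Ico ((k : ℝ) / (n : ℝ) ^ m) (((k : ℝ) + 1) / (n : ℝ) ^ m)

/-- The `n`-adic child number `j` (with `j = 0, …, n - 1`, from left to right) of the
`n`-adic interval `[k / n ^ m, (k + 1) / n ^ m)`. -/
def adicChild (n : ℕ) (m k : ℤ) (j : ℕ) : Set ℝ :=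
  adicInterval n (m + 1) (n * k + j)

/-- `μ` is an `n`-adic doubling measure on `X ⊆ ℝ`: for the `n`-adic intervals contained in `X`,
the ratio of the measures of any two children lies between `1 / C` and `C`, with one constant `C`.
The ratios make sense because all these measures are required to be positive and finite.
Only the values of `μ` on subsets of `X` matter. For `X = univ` this is `n`-adic doubling on `ℝ`. -/
def IsAdicDoublingOn (X : Set ℝ) (n : ℕ) (μ : Measure ℝ) : Prop :=
  ∃ C : ℝ, 0 < C ∧ ∀ m k : ℤ, adicInterval n m k ⊆ X →
    (∀ j < n, 0 < μ (adicChild n m k j) ∧ μ (adicChild n m k j) < ∞) ∧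
    ∀ i < n, ∀ j < n,
      1 / C ≤ μ.real (adicChild n m k i) / μ.real (adicChild n m k j) ∧
      μ.real (adicChild n m k i) / μ.real (adicChild n m k j) ≤ C

/-- `μ` is a doubling measure on `X ⊆ ℝ`: `μ (2I) ≤ C * μ I` for all intervals `I` of positive
length with `2I ⊆ X`, where `2I` has the same midpoint as `I` and twice its length.
Only the values of `μ` on subsets of `X` matter. For `X = univ` this is doubling on `ℝ`. -/
def IsDoublingOn (X : Set ℝ) (μ : Measure ℝ) : Prop :=
  ∃ C : ℝ≥0, ∀ c r : ℝ, 0 < r → Ico (c - 2 * r) (c + 2 * r) ⊆ X →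
    μ (Ico (c - 2 * r) (c + 2 * r)) ≤ C * μ (Ico (c - r) (c + r))

/-- The step function which is `b` on child number `s` of the `q`-adic interval
`[k / q ^ m, (k + 1) / q ^ m)`, is `a` on its other children, and is `1` off the interval. -/
noncomputable def childWeight (q : ℕ) (a b : ℝ) (m k : ℤ) (s : ℕ) (x : ℝ) : ℝ :=
  open Classical in
  if x ∈ adicChild q m k s then b else if x ∈ adicInterval q m k then a else 1

/-- Starting from `I = [k / q ^ m, (k + 1) / q ^ m)`, let `H⁽¹⁾` be the last but one child of `I`
and `H⁽ⁱ⁺¹⁾` the last child of `H⁽ⁱ⁾`. Then `H⁽ⁱ⁺¹⁾ = adicInterval q (m + i + 1) (hIndex q k i)`. -/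
def hIndex (q : ℕ) (k : ℤ) : ℕ → ℤ
  | 0 => q * k + (q - 2)
  | i + 1 => q * hIndex q k i + (q - 1)

/-- Starting from `I = [k / q ^ m, (k + 1) / q ^ m)`, let `G⁽¹⁾` be the last child of `I`
and `G⁽ⁱ⁺¹⁾` the first child of `G⁽ⁱ⁾`. Then `G⁽ⁱ⁺¹⁾ = adicInterval q (m + i + 1) (gIndex q k i)`. -/
def gIndex (q : ℕ) (k : ℤ) : ℕ → ℤ
  | 0 => q * k + (q - 1)
  | i + 1 => q * gIndex q k i

/-- The density, with respect to Lebesgue measure, that results from redistributing the mass of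
`I = [k / q ^ m, (k + 1) / q ^ m)` in `2 * α` steps. A redistribution on a `q`-adic interval
multiplies the mass of one distinguished child by `b` and the mass of its other children by `a`.
* Step `1` acts on `I`, and the last child is distinguished.
* Step `t` with `2 ≤ t ≤ α` acts on `H⁽ᵗ⁻¹⁾` and on `G⁽ᵗ⁻¹⁾`, and the first child is distinguished.
* Step `t` with `α + 1 ≤ t ≤ 2 * α`, `2 ≤ t`, acts on `H⁽ᵗ⁻¹⁾` and on `G⁽ᵗ⁻¹⁾`, and the last child
  is distinguished.

In the product below, `i` stands for `t - 2`. The density is `1` off `I`. -/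
noncomputable def blockDensity (q : ℕ) (a b : ℝ) (m k : ℤ) (α : ℕ) (x : ℝ) : ℝ :=
  childWeight q a b m k (q - 1) x *
    ∏ i ∈ Finset.range (2 * α - 1),
      (childWeight q a b (m + i + 1) (hIndex q k i) (if i + 2 ≤ α then 0 else q - 1) x *
        childWeight q a b (m + i + 1) (gIndex q k i) (if i + 2 ≤ α then 0 else q - 1) x)

/-- The intervals `I_ℓ = [k ℓ / q ^ m ℓ, (k ℓ + 1) / q ^ m ℓ)` form a sequence of pairwise disjoint
`q`-adic subintervals of `[0, 1)`, the numbers `α ℓ` are positive integers, and every value is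
attained by `α` only finitely often. -/
structure IsSelection (q : ℕ) (m k : ℕ → ℤ) (α : ℕ → ℕ) : Prop where
  subset_unit : ∀ l, adicInterval q (m l) (k l) ⊆ Ico 0 1
  disjoint : Pairwise fun l l' => Disjoint (adicInterval q (m l) (k l)) (adicInterval q (m l') (k l'))
  one_le : ∀ l, 1 ≤ α l
  finite_fiber : ∀ n, {l | α l = n}.Finite

/-- The measure on `ℝ` which is Lebesgue measure off the intervals `I_ℓ` and has on each `I_ℓ` the
density `blockDensity` with `2 * α ℓ` steps. (At most one factor of the product differs from `1` at
any given point, the intervals being disjoint.) -/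
noncomputable def reweightedMeasure (q : ℕ) (a b : ℝ) (m k : ℕ → ℤ) (α : ℕ → ℕ) : Measure ℝ :=
  volume.withDensity fun x => ENNReal.ofReal (∏ᶠ l, blockDensity q a b (m l) (k l) (α l) x)

/-- The family of the measures `reweightedMeasure q a b m k α`, for fixed intervals and fixed numbers
of steps, where `a` and `b` run over all weights with `0 < a < 1 < b` and `(q - 1) * a + b = q`. -/
def reweightedFamily (q : ℕ) (m k : ℕ → ℤ) (α : ℕ → ℕ) : Set (Measure ℝ) :=
  {μ | ∃ a b : ℝ, 0 < a ∧ a < 1 ∧ 1 < b ∧ ((q : ℝ) - 1) * a + b = q ∧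
    μ = reweightedMeasure q a b m k α}

theorem mem_adicInterval_iff_floor {n : ℕ} (hn : 0 < n) {m k : ℤ} {x : ℝ} :
    x ∈ adicInterval n m k ↔ ⌊x * (n : ℝ) ^ m⌋ = k := by
  have h : (0 : ℝ) < (n : ℝ) ^ m := by positivity
  rw [Int.floor_eq_iff, adicInterval, mem_Ico, div_le_iff₀ h, lt_div_iff₀ h]

/-- The position of a point in a fine grid determines its position in a coarse one. -/
theorem floor_mul_zpow_congr {n : ℕ} (hn : 0 < n) {r r' : ℤ} (hr : r ≤ r') {x y : ℝ}
    (h : ⌊x * (n : ℝ) ^ r'⌋ = ⌊y * (n : ℝ) ^ r'⌋) : ⌊x * (n : ℝ) ^ r⌋ = ⌊y * (n : ℝ) ^ r⌋ := by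
  obtain ⟨d, rfl⟩ := Int.le.dest hr
  have hn0 : (n : ℝ) ≠ 0 := by positivity
  have key : ∀ z : ℝ, z * (n : ℝ) ^ r = z * (n : ℝ) ^ (r + (d : ℤ)) / ((n ^ d : ℕ) : ℝ) := by
    intro z
    rw [zpow_add₀ hn0, zpow_natCast]
    push_cast
    field_simp
  rw [key x, key y, Int.floor_div_natCast, Int.floor_div_natCast, h]

theorem adicInterval_mem_congr {n : ℕ} (hn : 0 < n) {r r' k k' : ℤ} (hr : r ≤ r') {x y : ℝ}
    (hx : x ∈ adicInterval n r' k') (hy : y ∈ adicInterval n r' k') :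
    x ∈ adicInterval n r k ↔ y ∈ adicInterval n r k := by
  rw [mem_adicInterval_iff_floor hn] at *
  rw [mem_adicInterval_iff_floor hn, floor_mul_zpow_congr hn hr (hx.trans hy.symm)]

theorem adicInterval_subset_or_disjoint {n : ℕ} (hn : 0 < n) {r r' : ℤ} (hr : r ≤ r') (k k' : ℤ) :
    adicInterval n r' k' ⊆ adicInterval n r k ∨
      Disjoint (adicInterval n r' k') (adicInterval n r k) := by
  by_cases h : ∃ x ∈ adicInterval n r' k', x ∈ adicInterval n r k
  · obtain ⟨x, hx, hx'⟩ := h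
    exact Or.inl fun y hy => (adicInterval_mem_congr hn hr hx hy).1 hx'
  · push Not at h
    exact Or.inr (Set.disjoint_left.2 h)

theorem adicInterval_disjoint {n : ℕ} (hn : 0 < n) {r k k' : ℤ} (h : k ≠ k') :
    Disjoint (adicInterval n r k) (adicInterval n r k') := by
  rw [Set.disjoint_left]
  intro x hx hx'
  rw [mem_adicInterval_iff_floor hn] at hx hx'
  exact h (hx.symm.trans hx')

theorem adicChild_subset {n : ℕ} {m k : ℤ} {j : ℕ} (hj : j < n) :
    adicChild n m k j ⊆ adicInterval n m k := by
  have hn : 0 < n := by omega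
  have hn' : (0 : ℝ) < n := by exact_mod_cast hn
  have hm : (0 : ℝ) < (n : ℝ) ^ m := by positivity
  have hj' : (j : ℝ) + 1 ≤ n := by exact_mod_cast hj
  have hj0 : (0 : ℝ) ≤ j := by positivity
  rw [adicChild, adicInterval, adicInterval, zpow_add_one₀ hn'.ne']
  apply Ico_subset_Ico
  · rw [div_le_div_iff₀ hm (by positivity)]
    push_cast
    nlinarith [mul_nonneg hj0 hm.le]
  · rw [div_le_div_iff₀ (by positivity) hm]
    push_cast
    nlinarith [mul_le_mul_of_nonneg_right hj' hm.le]

theorem measurableSet_adicInterval {n : ℕ} {m k : ℤ} : MeasurableSet (adicInterval n m k) :=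
  measurableSet_Ico

theorem adicInterval_eq_Ico {n : ℕ} {m k : ℤ} :
    adicInterval n m k = Ico ((k : ℝ) / (n : ℝ) ^ m) ((k : ℝ) / (n : ℝ) ^ m + ((n : ℝ) ^ m)⁻¹) := by
  rw [adicInterval, add_div, one_div]

theorem volume_adicInterval {n : ℕ} {m k : ℤ} :
    volume (adicInterval n m k) = ENNReal.ofReal ((n : ℝ) ^ m)⁻¹ := by
  rw [adicInterval_eq_Ico, Real.volume_Ico, add_sub_cancel_left]

section Weights

variable {q : ℕ} {a b : ℝ}

theorem childWeight_mem_Icc (ha : a ≤ 1) (hb : 1 ≤ b) (m k : ℤ) (s : ℕ) (x : ℝ) :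
    childWeight q a b m k s x ∈ Icc a b := by
  unfold childWeight
  split_ifs <;> constructor <;> linarith

theorem childWeight_of_notMem {m k : ℤ} {s : ℕ} (hs : s < q) {x : ℝ}
    (hx : x ∉ adicInterval q m k) : childWeight q a b m k s x = 1 := by
  unfold childWeight
  rw [if_neg fun h => hx (adicChild_subset hs h), if_neg hx]

theorem childWeight_of_mem_adicChild {m k : ℤ} {s j : ℕ} (hj : j < q) {x : ℝ}
    (hx : x ∈ adicChild q m k j) : childWeight q a b m k s x = if j = s then b else a := by
  have hq : 0 < q := by omega
  unfold childWeight
  by_cases hjs : j = s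
  · subst hjs
    rw [if_pos hx, if_pos rfl]
  · rw [if_neg, if_pos (adicChild_subset hj hx), if_neg hjs]
    refine Set.disjoint_left.1 (adicInterval_disjoint hq ?_) hx
    omega

theorem childWeight_congr (hq : 0 < q) {m k : ℤ} {s : ℕ} {r k' : ℤ} (hr : m + 1 ≤ r) {x y : ℝ}
    (hx : x ∈ adicInterval q r k') (hy : y ∈ adicInterval q r k') :
    childWeight q a b m k s x = childWeight q a b m k s y := by
  have h₁ : x ∈ adicChild q m k s ↔ y ∈ adicChild q m k s := adicInterval_mem_congr hq hr hx hy
  have h₂ : x ∈ adicInterval q m k ↔ y ∈ adicInterval q m k :=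
    adicInterval_mem_congr hq (by omega) hx hy
  unfold childWeight
  split_ifs <;> first | rfl | tauto

/-- A redistribution step does not change the mass of a set that contains the interval or is
disjoint from it, if the density is constant on the interval. -/
theorem setLIntegral_mul_childWeight (ha : 0 ≤ a) (hb : 0 ≤ b) (hab : ((q : ℝ) - 1) * a + b = q)
    {m k : ℤ} {s : ℕ} (hs : s < q) {f : ℝ → ℝ} {c : ℝ} (hc : 0 ≤ c)
    (hf : ∀ x ∈ adicInterval q m k, f x = c) {A : Set ℝ}
    (hAm : MeasurableSet A)
    (hA : adicInterval q m k ⊆ A ∨ Disjoint (adicInterval q m k) A) :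
    ∫⁻ x in A, ENNReal.ofReal (f x * childWeight q a b m k s x) =
      ∫⁻ x in A, ENNReal.ofReal (f x) := by
  have hq : 0 < q := by omega
  have hq' : (0 : ℝ) < q := by exact_mod_cast hq
  set B := adicInterval q m k with hB
  have hBm : MeasurableSet B := measurableSet_adicInterval
  have off : ∀ x ∉ B, f x * childWeight q a b m k s x = f x := fun x hx => by
    rw [childWeight_of_notMem hs hx, mul_one]
  rcases hA with hBA | hBA
  · rw [← lintegral_inter_add_sdiff (fun x => ENNReal.ofReal (f x)) A hBm,
      ← lintegral_inter_add_sdiff (fun x => ENNReal.ofReal (f x * childWeight q a b m k s x)) A hBm,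
      inter_eq_self_of_subset_right hBA]
    congr 1
    · set D := adicChild q m k s with hD
      have hDm : MeasurableSet D := measurableSet_adicInterval
      have hDB : D ⊆ B := adicChild_subset hs
      rw [← lintegral_inter_add_sdiff (fun x => ENNReal.ofReal (f x * _)) B hDm,
        inter_eq_self_of_subset_right hDB]
      have e1 : ∫⁻ x in D, ENNReal.ofReal (f x * childWeight q a b m k s x) =
          ∫⁻ x in D, ENNReal.ofReal (c * b) := by
        refine setLIntegral_congr_fun hDm fun x hx => ?_
        simp only [hf x (hDB hx), childWeight_of_mem_adicChild hs hx, if_true]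
      have e2 : ∫⁻ x in B \ D, ENNReal.ofReal (f x * childWeight q a b m k s x) =
          ∫⁻ x in B \ D, ENNReal.ofReal (c * a) := by
        refine setLIntegral_congr_fun (hBm.diff hDm) fun x hx => ?_
        simp only [hf x hx.1, childWeight]
        rw [if_neg hx.2, if_pos hx.1]
      have e3 : ∫⁻ x in B, ENNReal.ofReal (f x) = ∫⁻ x in B, ENNReal.ofReal c :=
        setLIntegral_congr_fun hBm fun x hx => by simp only [hf x hx]
      have vB : volume B = ENNReal.ofReal ((q : ℝ) ^ m)⁻¹ := volume_adicInterval
      have vD : volume D = ENNReal.ofReal ((q : ℝ) ^ (m + 1))⁻¹ := volume_adicInterval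
      have hm : (0 : ℝ) < ((q : ℝ) ^ m)⁻¹ := by positivity
      have hqm : ((q : ℝ) ^ (m + 1))⁻¹ = ((q : ℝ) ^ m)⁻¹ / q := by
        rw [zpow_add_one₀ hq'.ne', mul_inv, div_eq_mul_inv]
      have hle : ((q : ℝ) ^ m)⁻¹ / q ≤ ((q : ℝ) ^ m)⁻¹ :=
        div_le_self hm.le (by exact_mod_cast hq)
      rw [e1, e2, e3, setLIntegral_const, setLIntegral_const, setLIntegral_const,
        measure_sdiff hDB hDm.nullMeasurableSet (by rw [vD]; exact ENNReal.ofReal_ne_top), vB, vD,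
        hqm, ← ENNReal.ofReal_sub _ (by positivity), ← ENNReal.ofReal_mul (by positivity),
        ← ENNReal.ofReal_mul (by positivity), ← ENNReal.ofReal_mul hc,
        ← ENNReal.ofReal_add (by positivity) (mul_nonneg (by positivity) (by linarith))]
      congr 1
      have hb' : b = q - (q - 1) * a := by linarith
      rw [hb']
      field_simp
      ring
    · exact setLIntegral_congr_fun (hAm.diff hBm) fun x hx => by simp only [off x hx.2]
  · exact setLIntegral_congr_fun hAm fun x hx => by
      simp only [off x (Set.disjoint_right.1 hBA hx)]

end Weights

/-- The intervals `H⁽ⁱ⁺¹⁾` (for `false`) and `G⁽ⁱ⁺¹⁾` (for `true`) of the construction. -/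
def flankSet (q : ℕ) (m k : ℤ) (σ : Bool) (i : ℕ) : Set ℝ :=
  adicInterval q (m + i + 1) (if σ then gIndex q k i else hIndex q k i)

/-- The left endpoint of the last child of an adic interval. -/
noncomputable def pivot (q : ℕ) (m k : ℤ) : ℝ := ((q : ℝ) * k + (q - 1)) / (q : ℝ) ^ (m + 1)

/-- The part of the real line to the right (for `true`) or to the left of the pivot. -/
def pivotSide (q : ℕ) (m k : ℤ) (σ : Bool) : Set ℝ :=
  if σ then Ici (pivot q m k) else Iio (pivot q m k)

/-- The factor that step number `i + 2` contributes to `blockDensity`. -/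
noncomputable def stepWeight (q : ℕ) (a b : ℝ) (m k : ℤ) (α i : ℕ) (x : ℝ) : ℝ :=
  childWeight q a b (m + i + 1) (hIndex q k i) (if i + 2 ≤ α then 0 else q - 1) x *
    childWeight q a b (m + i + 1) (gIndex q k i) (if i + 2 ≤ α then 0 else q - 1) x

/-- The density after `j + 1` steps. -/
noncomputable def partialDensity (q : ℕ) (a b : ℝ) (m k : ℤ) (α j : ℕ) (x : ℝ) : ℝ :=
  childWeight q a b m k (q - 1) x * ∏ i ∈ Finset.range j, stepWeight q a b m k α i x

section Geometry

variable {q : ℕ} {m k : ℤ}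

theorem gIndex_eq (i : ℕ) : gIndex q k i = q ^ i * (q * k + (q - 1)) := by
  induction i with
  | zero => simp [gIndex]
  | succ i ih => rw [gIndex, ih, pow_succ]; ring

theorem hIndex_eq (i : ℕ) : hIndex q k i = gIndex q k i - 1 := by
  induction i with
  | zero => simp only [gIndex, hIndex]; ring
  | succ i ih => rw [gIndex, hIndex, ih]; ring

theorem gIndex_div (hq : 0 < q) (i : ℕ) :
    (gIndex q k i : ℝ) / (q : ℝ) ^ (m + i + 1) = pivot q m k := by
  have hq' : (q : ℝ) ≠ 0 := by positivity
  rw [gIndex_eq, pivot, show m + i + 1 = m + 1 + (i : ℤ) by ring, zpow_add₀ hq' (m + 1),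
    zpow_natCast]
  push_cast
  field_simp

theorem flankSet_true (hq : 0 < q) (i : ℕ) : flankSet q m k true i =
    Ico (pivot q m k) (pivot q m k + ((q : ℝ) ^ (m + i + 1))⁻¹) := by
  rw [flankSet, adicInterval_eq_Ico, if_pos rfl, gIndex_div hq]

theorem flankSet_false (hq : 0 < q) (i : ℕ) : flankSet q m k false i =
    Ico (pivot q m k - ((q : ℝ) ^ (m + i + 1))⁻¹) (pivot q m k) := by
  rw [flankSet, adicInterval_eq_Ico, if_neg (by simp), hIndex_eq]
  push_cast
  rw [sub_div, gIndex_div hq, one_div, sub_add_cancel]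

theorem measurableSet_flankSet {σ : Bool} {i : ℕ} : MeasurableSet (flankSet q m k σ i) :=
  measurableSet_adicInterval

theorem flankSet_disjoint (hq : 0 < q) (i : ℕ) :
    Disjoint (flankSet q m k false i) (flankSet q m k true i) := by
  rw [flankSet_true hq, flankSet_false hq, Set.disjoint_left]
  exact fun x hx hx' => absurd hx.2 (not_lt.2 hx'.1)

theorem flankSet_subset_pivotSide (hq : 0 < q) (σ : Bool) (i : ℕ) :
    flankSet q m k σ i ⊆ pivotSide q m k σ := by
  cases σ
  · rw [flankSet_false hq]; exact fun x hx => hx.2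
  · rw [flankSet_true hq]; exact fun x hx => hx.1

theorem flankSet_succ_subset (hq : 0 < q) (σ : Bool) (i : ℕ) :
    flankSet q m k σ (i + 1) ⊆ flankSet q m k σ i := by
  have hq' : (0 : ℝ) < q := by exact_mod_cast hq
  have h1 : (1 : ℝ) ≤ q := by exact_mod_cast hq
  have : ((q : ℝ) ^ (m + (i + 1 : ℕ) + 1))⁻¹ ≤ ((q : ℝ) ^ (m + i + 1))⁻¹ := by
    apply inv_anti₀ (by positivity)
    exact zpow_le_zpow_right₀ h1 (by push_cast; omega)
  cases σ
  · rw [flankSet_false hq, flankSet_false hq]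
    exact Ico_subset_Ico (by linarith) le_rfl
  · rw [flankSet_true hq, flankSet_true hq]
    exact Ico_subset_Ico le_rfl (by linarith)

theorem flankSet_antitone (hq : 0 < q) (σ : Bool) : Antitone (flankSet q m k σ) :=
  antitone_nat_of_succ_le (flankSet_succ_subset hq σ)

theorem flankSet_zero_subset (hq : 2 ≤ q) (σ : Bool) :
    flankSet q m k σ 0 ⊆ adicInterval q m k := by
  cases σ
  · have := adicChild_subset (n := q) (m := m) (k := k) (j := q - 2) (by omega)
    convert! this using 1
    simp [flankSet, adicChild, hIndex, Nat.cast_sub hq]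
  · have := adicChild_subset (n := q) (m := m) (k := k) (j := q - 1) (by omega)
    convert! this using 1
    simp [flankSet, adicChild, gIndex, Nat.cast_sub (show 1 ≤ q by omega)]

theorem flankSet_subset (hq : 2 ≤ q) (σ : Bool) (i : ℕ) :
    flankSet q m k σ i ⊆ adicInterval q m k :=
  (flankSet_antitone (by omega) σ zero_le).trans (flankSet_zero_subset hq σ)

theorem abs_sub_pivot_le (hq : 0 < q) {σ : Bool} {i : ℕ} {x : ℝ} (hx : x ∈ flankSet q m k σ i) :
    |x - pivot q m k| ≤ ((q : ℝ) ^ (m + i + 1))⁻¹ := by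
  cases σ
  · rw [flankSet_false hq] at hx
    rw [abs_le]; constructor <;> linarith [hx.1, hx.2]
  · rw [flankSet_true hq] at hx
    rw [abs_le]; constructor <;> linarith [hx.1, hx.2]

theorem le_abs_sub_pivot (hq : 0 < q) {σ : Bool} {i : ℕ} {x : ℝ} (hs : x ∈ pivotSide q m k σ)
    (hx : x ∉ flankSet q m k σ i) : ((q : ℝ) ^ (m + i + 1))⁻¹ ≤ |x - pivot q m k| := by
  cases σ
  · rw [flankSet_false hq, mem_Ico, not_and_or, not_le, not_lt] at hx
    have hs' : x < pivot q m k := hs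
    rw [le_abs]; right
    rcases hx with h | h <;> linarith
  · rw [flankSet_true hq, mem_Ico, not_and_or, not_le, not_lt] at hx
    have hs' : pivot q m k ≤ x := hs
    rw [le_abs]; left
    rcases hx with h | h <;> linarith

end Geometry

section Densities

variable {q : ℕ} {a b : ℝ} {m k : ℤ} {α : ℕ}

theorem blockDensity_eq : blockDensity q a b m k α = partialDensity q a b m k α (2 * α - 1) := rfl

theorem partialDensity_succ (j : ℕ) (x : ℝ) : partialDensity q a b m k α (j + 1) x =
    partialDensity q a b m k α j x * stepWeight q a b m k α j x := by
  rw [partialDensity, Finset.prod_range_succ, partialDensity, mul_assoc]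

theorem stepWeight_of_notMem (hq : 0 < q) {i : ℕ} {x : ℝ} (h : ∀ σ, x ∉ flankSet q m k σ i) :
    stepWeight q a b m k α i x = 1 := by
  have hs : (if i + 2 ≤ α then 0 else q - 1) < q := by split_ifs <;> omega
  rw [stepWeight, childWeight_of_notMem hs (by simpa [flankSet] using h false),
    childWeight_of_notMem hs (by simpa [flankSet] using h true), mul_one]

theorem notMem_flankSet_of_mem_pivotSide (hq : 0 < q) {σ : Bool} {i : ℕ} {x : ℝ}
    (hs : x ∈ pivotSide q m k (!σ)) : x ∉ flankSet q m k σ i := by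
  intro hx
  have h := flankSet_subset_pivotSide hq σ i hx
  cases σ
  · exact absurd (show x < pivot q m k from h) (not_lt.2 hs)
  · exact absurd (show x < pivot q m k from hs) (not_lt.2 h)

theorem mem_pivotSide_or (x : ℝ) : x ∈ pivotSide q m k true ∨ x ∈ pivotSide q m k false :=
  le_or_gt (pivot q m k) x

theorem exists_mem_pivotSide (x : ℝ) : ∃ σ, x ∈ pivotSide q m k σ :=
  (mem_pivotSide_or x).elim (fun h => ⟨_, h⟩) fun h => ⟨_, h⟩

theorem stepWeight_eq_of_mem_pivotSide (hq : 0 < q) {σ : Bool} {i : ℕ} {x : ℝ}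
    (hs : x ∈ pivotSide q m k σ) : stepWeight q a b m k α i x =
      childWeight q a b (m + i + 1) (if σ then gIndex q k i else hIndex q k i)
        (if i + 2 ≤ α then 0 else q - 1) x := by
  have hs' : (if i + 2 ≤ α then 0 else q - 1) < q := by split_ifs <;> omega
  have hn : x ∉ flankSet q m k (!σ) i :=
    notMem_flankSet_of_mem_pivotSide hq (by simpa using hs)
  cases σ
  · rw [stepWeight, childWeight_of_notMem (k := gIndex q k i) hs' (by simpa [flankSet] using hn)]
    simp
  · rw [stepWeight, childWeight_of_notMem (k := hIndex q k i) hs' (by simpa [flankSet] using hn)]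
    simp

theorem stepWeight_of_notMem_flankSet (hq : 0 < q) {σ : Bool} {i : ℕ} {x : ℝ}
    (hs : x ∈ pivotSide q m k σ) (hx : x ∉ flankSet q m k σ i) :
    stepWeight q a b m k α i x = 1 := by
  have hs' : (if i + 2 ≤ α then 0 else q - 1) < q := by split_ifs <;> omega
  rw [stepWeight_eq_of_mem_pivotSide hq hs, childWeight_of_notMem hs' hx]

theorem stepWeight_mem_Icc (hq : 0 < q) (ha : a ≤ 1) (hb : 1 ≤ b) (i : ℕ) (x : ℝ) :
    stepWeight q a b m k α i x ∈ Icc a b := by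
  obtain ⟨σ, hσ⟩ := exists_mem_pivotSide (q := q) (m := m) (k := k) x
  rw [stepWeight_eq_of_mem_pivotSide hq hσ]
  exact childWeight_mem_Icc ha hb _ _ _ _

/-- The value of `stepWeight` near the pivot. -/
theorem stepWeight_of_mem_flankSet_succ (hq : 2 ≤ q) {σ : Bool} {i : ℕ} {x : ℝ}
    (hx : x ∈ flankSet q m k σ (i + 1)) :
    stepWeight q a b m k α i x = if (i + 2 ≤ α ↔ σ = true) then b else a := by
  rw [stepWeight_eq_of_mem_pivotSide (by omega) (flankSet_subset_pivotSide (by omega) σ _ hx)]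
  cases σ
  · rw [childWeight_of_mem_adicChild (j := q - 1) (by omega)]
    · by_cases h : i + 2 ≤ α
      · have : q - 1 ≠ 0 := by omega
        simp [h, this]
      · simp [h]
    · convert! hx using 1
      simp only [flankSet, adicChild, hIndex, Nat.cast_sub (show 1 ≤ q by omega)]
      simp [add_assoc]
  · rw [childWeight_of_mem_adicChild (j := 0) (by omega)]
    · by_cases h : i + 2 ≤ α
      · simp [h]
      · have : 0 ≠ q - 1 := by omega
        simp [h, this]
    · convert! hx using 1
      simp only [flankSet, adicChild, gIndex]
      simp [add_assoc]

theorem stepWeight_congr (hq : 0 < q) {i : ℕ} {r k' : ℤ} (hr : m + i + 2 ≤ r) {x y : ℝ}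
    (hx : x ∈ adicInterval q r k') (hy : y ∈ adicInterval q r k') :
    stepWeight q a b m k α i x = stepWeight q a b m k α i y := by
  rw [stepWeight, stepWeight, childWeight_congr hq (by omega) hx hy,
    childWeight_congr hq (by omega) hx hy]

theorem partialDensity_congr (hq : 0 < q) {j : ℕ} {r k' : ℤ} (hr : m + j + 1 ≤ r) {x y : ℝ}
    (hx : x ∈ adicInterval q r k') (hy : y ∈ adicInterval q r k') :
    partialDensity q a b m k α j x = partialDensity q a b m k α j y := by
  rw [partialDensity, partialDensity, childWeight_congr hq (by omega) hx hy]
  congr 1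
  refine Finset.prod_congr rfl fun i hi => stepWeight_congr hq ?_ hx hy
  have := Finset.mem_range.1 hi
  omega

theorem partialDensity_pos (hq : 0 < q) (ha : 0 < a) (ha' : a ≤ 1) (hb : 1 ≤ b) (j : ℕ) (x : ℝ) :
    0 < partialDensity q a b m k α j x :=
  mul_pos (ha.trans_le (childWeight_mem_Icc ha' hb _ _ _ _).1)
    (Finset.prod_pos fun i _ => ha.trans_le (stepWeight_mem_Icc hq ha' hb i x).1)

theorem partialDensity_of_notMem (hq : 2 ≤ q) {j : ℕ} {x : ℝ} (hx : x ∉ adicInterval q m k) :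
    partialDensity q a b m k α j x = 1 := by
  rw [partialDensity, childWeight_of_notMem (by omega) hx, one_mul]
  exact Finset.prod_eq_one fun i _ => stepWeight_of_notMem (by omega)
    fun σ h => hx (flankSet_subset hq σ i h)

/-- Off the first pair of flanks only the first step changes the density. -/
theorem partialDensity_of_notMem_flankSet {j : ℕ} (hq : 0 < q) {σ : Bool} {x : ℝ}
    (hs : x ∈ pivotSide q m k σ) (hx : x ∉ flankSet q m k σ 0) :
    partialDensity q a b m k α j x = childWeight q a b m k (q - 1) x := by
  have hn : ∀ i, x ∉ flankSet q m k σ i := fun i h => hx (flankSet_antitone hq σ zero_le h)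
  rw [partialDensity, Finset.prod_eq_one, mul_one]
  exact fun i _ => stepWeight_of_notMem_flankSet hq hs (hn i)

/-- The density on the `j`-th flank after `j + 1` steps. -/
theorem partialDensity_of_mem_flankSet (hq : 2 ≤ q) {σ : Bool} {j : ℕ} {x : ℝ}
    (hx : x ∈ flankSet q m k σ j) : partialDensity q a b m k α j x =
      (if σ then b else a) *
        ∏ i ∈ Finset.range j, if (i + 2 ≤ α ↔ σ = true) then b else a := by
  have mem : ∀ i ≤ j, x ∈ flankSet q m k σ i := fun i hi => flankSet_antitone (by omega) σ hi hx
  rw [partialDensity]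
  congr 1
  · have h0 := mem 0 (by omega)
    cases σ
    · rw [childWeight_of_mem_adicChild (j := q - 2) (by omega)]
      · rw [if_neg (by omega)]; simp
      · convert! h0 using 1
        simp [flankSet, adicChild, hIndex, Nat.cast_sub hq]
    · rw [childWeight_of_mem_adicChild (j := q - 1) (by omega)]
      · simp
      · convert! h0 using 1
        simp [flankSet, adicChild, gIndex, Nat.cast_sub (show 1 ≤ q by omega)]
  · exact Finset.prod_congr rfl fun i hi =>
      stepWeight_of_mem_flankSet_succ hq (mem _ (Finset.mem_range.1 hi))

end Densities

/-- The weights that occur in `reweightedFamily`. -/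
structure IsWeightPair (q : ℕ) (a b : ℝ) : Prop where
  two_le : 2 ≤ q
  pos : 0 < a
  lt_one : a < 1
  one_lt : 1 < b
  sum_eq : ((q : ℝ) - 1) * a + b = q

/-- The measure with density `blockDensity`. -/
noncomputable def blockMeasure (q : ℕ) (a b : ℝ) (m k : ℤ) (α : ℕ) : Measure ℝ :=
  volume.withDensity fun x => ENNReal.ofReal (blockDensity q a b m k α x)

section

variable {q : ℕ} {a b : ℝ} {m k : ℤ} {α : ℕ}

theorem blockMeasure_apply {A : Set ℝ} (hA : MeasurableSet A) : blockMeasure q a b m k α A =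
    ∫⁻ x in A, ENNReal.ofReal (partialDensity q a b m k α (2 * α - 1) x) :=
  withDensity_apply _ hA

theorem blockMeasure_eq_of_forall {A : Set ℝ} (hA : MeasurableSet A)
    {c : ℝ} (hc : ∀ x ∈ A, blockDensity q a b m k α x = c) :
    blockMeasure q a b m k α A = ENNReal.ofReal c * volume A := by
  rw [blockMeasure, withDensity_apply _ hA, ← setLIntegral_const]
  exact setLIntegral_congr_fun hA fun x hx => by simp only [hc x hx]

theorem blockMeasure_le {A : Set ℝ} (hA : MeasurableSet A)
    {c : ℝ} (hc : ∀ x ∈ A, blockDensity q a b m k α x ≤ c) :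
    blockMeasure q a b m k α A ≤ ENNReal.ofReal c * volume A := by
  rw [blockMeasure, withDensity_apply _ hA, ← setLIntegral_const]
  exact setLIntegral_mono' hA fun x hx => ENNReal.ofReal_le_ofReal (hc x hx)

theorem le_blockMeasure {A : Set ℝ} (hA : MeasurableSet A)
    {c : ℝ} (hc : ∀ x ∈ A, c ≤ blockDensity q a b m k α x) :
    ENNReal.ofReal c * volume A ≤ blockMeasure q a b m k α A := by
  rw [blockMeasure, withDensity_apply _ hA, ← setLIntegral_const]
  exact setLIntegral_mono' hA fun x hx => ENNReal.ofReal_le_ofReal (hc x hx)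

namespace IsWeightPair

theorem q_pos (h : IsWeightPair q a b) : 0 < q := zero_lt_two.trans_le h.two_le

theorem b_pos (h : IsWeightPair q a b) : 0 < b := zero_lt_one.trans h.one_lt

theorem lt (h : IsWeightPair q a b) : a < b := h.lt_one.trans h.one_lt

theorem partialDensity_pos (h : IsWeightPair q a b) (j : ℕ) (x : ℝ) :
    0 < partialDensity q a b m k α j x :=
  _root_.partialDensity_pos h.q_pos h.pos h.lt_one.le h.one_lt.le j x

theorem blockDensity_pos (h : IsWeightPair q a b) (x : ℝ) : 0 < blockDensity q a b m k α x :=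
  h.partialDensity_pos _ x

theorem setLIntegral_partialDensity_succ (h : IsWeightPair q a b) {j : ℕ} {A : Set ℝ}
    (hAm : MeasurableSet A)
    (hA : ∀ σ, flankSet q m k σ j ⊆ A ∨ Disjoint (flankSet q m k σ j) A) :
    ∫⁻ x in A, ENNReal.ofReal (partialDensity q a b m k α (j + 1) x) =
      ∫⁻ x in A, ENNReal.ofReal (partialDensity q a b m k α j x) := by
  have hq := h.q_pos
  have hs : (if j + 2 ≤ α then 0 else q - 1) < q := by split_ifs <;> omega
  have hdisj := flankSet_disjoint (q := q) (m := m) (k := k) hq j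
  have hq' : (0 : ℝ) < q := by exact_mod_cast hq
  have left_mem : ∀ l : ℤ, (l : ℝ) / (q : ℝ) ^ (m + j + 1) ∈ adicInterval q (m + j + 1) l :=
    fun l => by
      rw [adicInterval_eq_Ico, left_mem_Ico, lt_add_iff_pos_right]
      positivity
  have e := fun x => partialDensity_succ (q := q) (a := a) (b := b) (m := m) (k := k) (α := α) j x
  have c0 := fun l : ℤ => (h.partialDensity_pos (m := m) (k := k) (α := α) j
    ((l : ℝ) / (q : ℝ) ^ (m + j + 1))).le
  simp only [e, stepWeight, ← mul_assoc]
  rw [setLIntegral_mul_childWeight h.pos.le h.b_pos.le h.sum_eq hs (c0 (gIndex q k j)) ?_ hAm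
      (by simpa [flankSet] using hA true),
    setLIntegral_mul_childWeight h.pos.le h.b_pos.le h.sum_eq hs (c0 (hIndex q k j)) ?_ hAm
      (by simpa [flankSet] using hA false)]
  · exact fun x hx => partialDensity_congr hq le_rfl hx (left_mem _)
  · intro x hx
    have hx' : x ∉ adicInterval q (m + j + 1) (hIndex q k j) := by
      have := Set.disjoint_right.1 hdisj (by simpa [flankSet] using hx)
      simpa [flankSet] using this
    rw [childWeight_of_notMem hs hx', mul_one]
    exact partialDensity_congr hq le_rfl hx (left_mem _)

theorem setLIntegral_partialDensity (h : IsWeightPair q a b) {i j : ℕ} (hij : i ≤ j) {r k' : ℤ}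
    (hr : r ≤ m + i + 1) :
    ∫⁻ x in adicInterval q r k', ENNReal.ofReal (partialDensity q a b m k α j x) =
      ∫⁻ x in adicInterval q r k', ENNReal.ofReal (partialDensity q a b m k α i x) := by
  induction j, hij using Nat.le_induction with
  | base => rfl
  | succ j hij ih =>
    rw [h.setLIntegral_partialDensity_succ measurableSet_adicInterval, ih]
    exact fun σ => adicInterval_subset_or_disjoint h.q_pos (by omega) _ _

/-- The construction does not change the mass of intervals at least as long as the given one. -/
theorem blockMeasure_adicInterval_of_le (h : IsWeightPair q a b) {r k' : ℤ} (hr : r ≤ m) :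
    blockMeasure q a b m k α (adicInterval q r k') = volume (adicInterval q r k') := by
  rw [blockMeasure_apply measurableSet_adicInterval,
    h.setLIntegral_partialDensity zero_le (by simp; omega)]
  have := setLIntegral_mul_childWeight (m := m) (k := k) (s := q - 1) h.pos.le h.b_pos.le h.sum_eq
    (by have := h.q_pos; omega) (f := fun _ => 1) zero_le_one (fun _ _ => rfl)
    (measurableSet_adicInterval (n := q) (m := r) (k := k'))
    (adicInterval_subset_or_disjoint h.q_pos hr _ _)
  simp only [one_mul] at this
  simp only [partialDensity, Finset.range_zero, Finset.prod_empty, mul_one, this]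
  simp

/-- The mass of a short interval is determined by the first steps. -/
theorem blockMeasure_adicInterval (h : IsWeightPair q a b) {j : ℕ} {k' : ℤ} {x : ℝ}
    (hx : x ∈ adicInterval q (m + j + 1) k') :
    blockMeasure q a b m k α (adicInterval q (m + j + 1) k') =
      ENNReal.ofReal (partialDensity q a b m k α (min j (2 * α - 1)) x *
        ((q : ℝ) ^ (m + j + 1))⁻¹) := by
  have hP : ∀ y ∈ adicInterval q (m + j + 1) k', partialDensity q a b m k α (min j (2 * α - 1)) y =
      partialDensity q a b m k α (min j (2 * α - 1)) x :=
    fun y hy => partialDensity_congr h.q_pos (by omega) hy hx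
  rw [ENNReal.ofReal_mul (h.partialDensity_pos _ _).le, ← volume_adicInterval (k := k'),
    ← setLIntegral_const, blockMeasure_apply measurableSet_adicInterval]
  rcases le_total j (2 * α - 1) with hj | hj
  · rw [min_eq_left hj] at hP ⊢
    rw [h.setLIntegral_partialDensity hj le_rfl]
    exact setLIntegral_congr_fun measurableSet_adicInterval fun y hy => by simp only [hP y hy]
  · rw [min_eq_right hj] at hP ⊢
    exact setLIntegral_congr_fun measurableSet_adicInterval fun y hy => by simp only [hP y hy]

theorem blockMeasure_flankSet (h : IsWeightPair q a b) {σ : Bool} {j : ℕ} {x : ℝ}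
    (hx : x ∈ flankSet q m k σ j) : blockMeasure q a b m k α (flankSet q m k σ j) =
      ENNReal.ofReal (partialDensity q a b m k α (min j (2 * α - 1)) x *
        ((q : ℝ) ^ (m + j + 1))⁻¹) :=
  h.blockMeasure_adicInterval hx

end IsWeightPair

end

theorem Finset.card_le_of_forall_le_add {s : Finset ℕ} {d : ℕ}
    (h : ∀ i ∈ s, ∀ j ∈ s, j ≤ i + d) : s.card ≤ d + 1 := by
  rcases s.eq_empty_or_nonempty with rfl | hs
  · simp
  · calc s.card ≤ (Finset.Icc (s.min' hs) (s.min' hs + d)).card :=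
        Finset.card_le_card fun j hj =>
          Finset.mem_Icc.2 ⟨s.min'_le j hj, h _ (s.min'_mem hs) j hj⟩
      _ = d + 1 := by rw [Nat.card_Icc]; omega

section

variable {q : ℕ} {a b : ℝ} {m k : ℤ} {α : ℕ}

theorem inv_zpow_scale_le_iff (hq : 2 ≤ q) {r r' : ℤ} :
    ((q : ℝ) ^ r)⁻¹ ≤ ((q : ℝ) ^ r')⁻¹ ↔ r' ≤ r := by
  have h1 : (1 : ℝ) < q := by exact_mod_cast hq
  rw [inv_le_inv₀ (by positivity) (by positivity), zpow_le_zpow_iff_right₀ h1]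

theorem nonempty_flankSet (hq : 0 < q) {σ : Bool} {i : ℕ} : (flankSet q m k σ i).Nonempty := by
  have hq' : (0 : ℝ) < q := by exact_mod_cast hq
  have h : 0 < ((q : ℝ) ^ (m + i + 1))⁻¹ := by positivity
  cases σ
  · rw [flankSet_false hq]; exact nonempty_Ico.2 (by linarith)
  · rw [flankSet_true hq]; exact nonempty_Ico.2 (by linarith)

/-- Steps that change the ratio of the densities at two points on the same side of the pivot. -/
theorem le_add_of_stepWeight_ne (hq : 2 ≤ q) {σ : Bool} {x y : ℝ} (hx : x ∈ pivotSide q m k σ)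
    (hy : y ∈ pivotSide q m k σ) {R : ℕ}
    (hxy : |x - pivot q m k| ≤ (q : ℝ) ^ R * |y - pivot q m k|)
    (hyx : |y - pivot q m k| ≤ (q : ℝ) ^ R * |x - pivot q m k|) {i j : ℕ}
    (hi : stepWeight q a b m k α i x ≠ stepWeight q a b m k α i y)
    (hj : stepWeight q a b m k α j x ≠ stepWeight q a b m k α j y) : j ≤ i + (R + 1) := by
  have hq0 : 0 < q := by omega
  have hqr : (0 : ℝ) < q := by exact_mod_cast hq0
  have hR : (1 : ℝ) ≤ (q : ℝ) ^ R := one_le_pow₀ (by exact_mod_cast hq0)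
  have far : ∃ z ∈ ({x, y} : Set ℝ), z ∉ flankSet q m k σ (i + 1) := by
    by_contra! hc
    exact hi (by rw [stepWeight_of_mem_flankSet_succ hq (hc x (by simp)),
      stepWeight_of_mem_flankSet_succ hq (hc y (by simp))])
  have near : ∃ z ∈ ({x, y} : Set ℝ), z ∈ flankSet q m k σ j := by
    by_contra! hc
    exact hj (by rw [stepWeight_of_notMem_flankSet hq0 hx (hc x (by simp)),
      stepWeight_of_notMem_flankSet hq0 hy (hc y (by simp))])
  obtain ⟨u, hu, hu'⟩ := far
  obtain ⟨v, hv, hv'⟩ := near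
  have huv : |u - pivot q m k| ≤ (q : ℝ) ^ R * |v - pivot q m k| := by
    rcases hu with rfl | rfl <;> rcases hv with rfl | rfl
    · exact le_mul_of_one_le_left (abs_nonneg _) hR
    · exact hxy
    · exact hyx
    · exact le_mul_of_one_le_left (abs_nonneg _) hR
  have hus : u ∈ pivotSide q m k σ := by
    rcases hu with rfl | rfl <;> assumption
  have h1 := le_abs_sub_pivot hq0 hus hu'
  have h2 := abs_sub_pivot_le hq0 hv'
  have h3 : ((q : ℝ) ^ (m + (i + 1 : ℕ) + 1))⁻¹ ≤ ((q : ℝ) ^ (m + j + 1 - R))⁻¹ := by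
    rw [zpow_sub₀ hqr.ne', inv_div, zpow_natCast, div_eq_mul_inv]
    exact (h1.trans huv).trans (mul_le_mul_of_nonneg_left h2 (by positivity))
  rw [inv_zpow_scale_le_iff hq] at h3
  push_cast at h3
  omega

namespace IsWeightPair

theorem one_le_ratio (h : IsWeightPair q a b) : 1 ≤ b / a :=
  (one_le_div h.pos).2 h.lt.le

theorem le_ratio_mul (h : IsWeightPair q a b) {u v : ℝ} (hu : u ∈ Icc a b) (hv : v ∈ Icc a b) :
    u ≤ b / a * v := by
  have := h.pos
  rw [div_mul_eq_mul_div, le_div_iff₀ h.pos]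
  nlinarith [hu.1, hu.2, hv.1, hv.2]

/-- The density is comparable at two points on the same side of the pivot whose distances from it
are comparable. -/
theorem blockDensity_le_mul (h : IsWeightPair q a b) {σ : Bool} {x y : ℝ}
    (hx : x ∈ pivotSide q m k σ) (hy : y ∈ pivotSide q m k σ) {R : ℕ}
    (hxy : |x - pivot q m k| ≤ (q : ℝ) ^ R * |y - pivot q m k|)
    (hyx : |y - pivot q m k| ≤ (q : ℝ) ^ R * |x - pivot q m k|) :
    blockDensity q a b m k α x ≤ (b / a) ^ (R + 3) * blockDensity q a b m k α y := by
  classical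
  have hΓ := h.one_le_ratio
  have hpos : ∀ i z, 0 < stepWeight q a b m k α i z := fun i z =>
    h.pos.trans_le (stepWeight_mem_Icc h.q_pos h.lt_one.le h.one_lt.le i z).1
  set J := 2 * α - 1 with hJ
  have hprod : ∏ i ∈ Finset.range J, stepWeight q a b m k α i x ≤
      (b / a) ^ (R + 2) * ∏ i ∈ Finset.range J, stepWeight q a b m k α i y := by
    calc ∏ i ∈ Finset.range J, stepWeight q a b m k α i x
        ≤ ∏ i ∈ Finset.range J,
          ((if stepWeight q a b m k α i x ≠ stepWeight q a b m k α i y then b / a else 1) *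
            stepWeight q a b m k α i y) := by
          refine Finset.prod_le_prod (fun i _ => (hpos i x).le) fun i _ => ?_
          split_ifs with hne
          · exact h.le_ratio_mul (stepWeight_mem_Icc h.q_pos h.lt_one.le h.one_lt.le i x)
              (stepWeight_mem_Icc h.q_pos h.lt_one.le h.one_lt.le i y)
          · rw [one_mul]; exact (not_not.1 hne).le
      _ ≤ _ := by
          rw [Finset.prod_mul_distrib]
          refine mul_le_mul_of_nonneg_right ?_ (Finset.prod_nonneg fun i _ => (hpos i y).le)
          rw [← Finset.prod_filter, Finset.prod_const]
          refine pow_le_pow_right₀ hΓ (Finset.card_le_of_forall_le_add fun i hi j hj => ?_)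
          exact le_add_of_stepWeight_ne h.two_le hx hy hxy hyx (Finset.mem_filter.1 hi).2
            (Finset.mem_filter.1 hj).2
  have hcw := h.le_ratio_mul
    (childWeight_mem_Icc (q := q) h.lt_one.le h.one_lt.le m k (q - 1) x)
    (childWeight_mem_Icc (q := q) h.lt_one.le h.one_lt.le m k (q - 1) y)
  have hcw0 := h.pos.trans_le (childWeight_mem_Icc (q := q) h.lt_one.le h.one_lt.le m k (q - 1) y).1
  rw [blockDensity_eq, partialDensity, partialDensity, ← hJ]
  calc _ ≤ (b / a * childWeight q a b m k (q - 1) y) *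
        ((b / a) ^ (R + 2) * ∏ i ∈ Finset.range J, stepWeight q a b m k α i y) :=
        mul_le_mul hcw hprod (Finset.prod_nonneg fun i _ => (hpos i x).le) (by positivity)
    _ = _ := by ring

/-- The density is determined by the first steps up to a bounded factor. -/
theorem mul_partialDensity_le (h : IsWeightPair q a b) {σ : Bool} {x : ℝ}
    (hx : x ∈ pivotSide q m k σ) {t : ℕ} (ht : x ∉ flankSet q m k σ (t + 2)) :
    a ^ 2 * partialDensity q a b m k α (min t (2 * α - 1)) x ≤ blockDensity q a b m k α x := by
  have ha := h.pos
  have ha1 := h.lt_one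
  have P0 := h.partialDensity_pos (m := m) (k := k) (α := α)
  have step : ∀ j, a * partialDensity q a b m k α j x ≤ partialDensity q a b m k α (j + 1) x := by
    intro j
    rw [partialDensity_succ, mul_comm]
    exact mul_le_mul_of_nonneg_left
      (stepWeight_mem_Icc h.q_pos h.lt_one.le h.one_lt.le j x).1 (P0 j x).le
  have stable : ∀ j, t + 2 ≤ j →
      partialDensity q a b m k α j x = partialDensity q a b m k α (t + 2) x := by
    intro j hj
    induction j, hj using Nat.le_induction with
    | base => rfl
    | succ j hj ih =>
      rw [partialDensity_succ, ih, stepWeight_of_notMem_flankSet h.q_pos hx, mul_one]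
      exact fun hc => ht (flankSet_antitone h.q_pos σ hj hc)
  rw [blockDensity_eq]
  rcases le_or_gt (2 * α - 1) t with hJ | hJ
  · rw [min_eq_right hJ]
    exact mul_le_of_le_one_left (P0 _ x).le (pow_le_one₀ ha.le ha1.le)
  · rw [min_eq_left hJ.le]
    rcases (show 2 * α - 1 = t + 1 ∨ t + 2 ≤ 2 * α - 1 by omega) with hJ' | hJ'
    · rw [hJ']
      nlinarith [P0 t x, step t, mul_pos ha (P0 t x)]
    · rw [stable _ hJ']
      nlinarith [step t, step (t + 1)]

/-- The mass between the pivot and a point is controlled by the density at the point. -/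
theorem blockMeasure_le_of_near (h : IsWeightPair q a b) {σ : Bool} {x ρ : ℝ} {A : Set ℝ}
    (hAm : MeasurableSet A)
    (hx : x ∈ pivotSide q m k σ) (hρ : 0 < ρ) (hxρ : |x - pivot q m k| = ρ)
    (hA : A ⊆ pivotSide q m k σ) (hAρ : ∀ y ∈ A, |y - pivot q m k| ≤ ρ) :
    blockMeasure q a b m k α A ≤
      ENNReal.ofReal (3 * q / a ^ 3 * (ρ * blockDensity q a b m k α x)) := by
  have hq0 := h.q_pos
  have hqr : (0 : ℝ) < q := by exact_mod_cast hq0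
  have hq1 : (1 : ℝ) < q := by exact_mod_cast h.two_le
  have ha := h.pos
  have hb := h.b_pos
  have hbq : b ≤ q := by nlinarith [h.sum_eq]
  have ha3 : a ^ 3 ≤ a ^ 2 := pow_le_pow_of_le_one ha.le h.lt_one.le (by norm_num)
  have scale_succ : ∀ r : ℤ, ((q : ℝ) ^ r)⁻¹ = q * ((q : ℝ) ^ (r + 1))⁻¹ := fun r => by
    rw [zpow_add_one₀ hqr.ne']; field_simp
  have scale_pos : ∀ r : ℤ, 0 < ((q : ℝ) ^ r)⁻¹ := fun r => by positivity
  rcases le_or_gt ((q : ℝ) ^ (m + (0 : ℕ) + 1))⁻¹ ρ with hlarge | hsmall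
  · have hx2 : x ∉ flankSet q m k σ (0 + 2) := fun hx2 => by
      have h1 := abs_sub_pivot_le hq0 hx2
      rw [hxρ] at h1
      have h2 := hlarge.trans h1
      rw [inv_zpow_scale_le_iff h.two_le] at h2
      push_cast at h2
      omega
    have hw := h.mul_partialDensity_le (α := α) hx hx2
    have hcw : ∀ y, partialDensity q a b m k α (min 0 (2 * α - 1)) y ∈ Icc a b := fun y => by
      rw [zero_min, partialDensity, Finset.range_zero, Finset.prod_empty, mul_one]
      exact childWeight_mem_Icc h.lt_one.le h.one_lt.le _ _ _ _
    obtain ⟨z, hz⟩ := nonempty_flankSet (q := q) (m := m) (k := k) (σ := σ) (i := 0) hq0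
    have hT : blockMeasure q a b m k α (A ∩ flankSet q m k σ 0) ≤ ENNReal.ofReal (b * ρ) := by
      refine (measure_mono inter_subset_right).trans ?_
      rw [h.blockMeasure_flankSet hz]
      exact ENNReal.ofReal_le_ofReal (mul_le_mul (hcw z).2 hlarge (scale_pos _).le hb.le)
    have hD : blockMeasure q a b m k α (A \ flankSet q m k σ 0) ≤ ENNReal.ofReal (b * (2 * ρ)) := by
      refine (blockMeasure_le (c := b) (hAm.diff measurableSet_flankSet) fun y hy => ?_).trans ?_
      · rw [blockDensity_eq, partialDensity_of_notMem_flankSet hq0 (hA hy.1) hy.2]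
        exact (childWeight_mem_Icc h.lt_one.le h.one_lt.le _ _ _ _).2
      · rw [ENNReal.ofReal_mul hb.le]
        gcongr
        calc volume (A \ flankSet q m k σ 0)
            ≤ volume (Icc (pivot q m k - ρ) (pivot q m k + ρ)) := measure_mono fun y hy => by
              have := abs_le.1 (hAρ y hy.1)
              constructor <;> linarith
          _ = ENNReal.ofReal (2 * ρ) := by rw [Real.volume_Icc]; congr 1; ring
    rw [← measure_inter_add_sdiff A (measurableSet_flankSet (q := q) (m := m) (k := k) (σ := σ)
      (i := 0))]
    refine (add_le_add hT hD).trans ?_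
    rw [← ENNReal.ofReal_add (by positivity) (by positivity)]
    apply ENNReal.ofReal_le_ofReal
    have hwa : a ^ 3 ≤ blockDensity q a b m k α x := by
      nlinarith [(hcw x).1, pow_pos ha 2]
    calc b * ρ + b * (2 * ρ) = 3 * b * ρ := by ring
      _ ≤ 3 * q * ρ := by gcongr
      _ = 3 * q / a ^ 3 * (ρ * a ^ 3) := by field_simp
      _ ≤ _ := by gcongr
  · obtain ⟨n, hn1, hn2⟩ := exists_mem_Ico_zpow hρ hq1
    have hn : n < -(m + 1) := by
      have h1 : (q : ℝ) ^ n < (q : ℝ) ^ (-(m + 1)) := by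
        rw [zpow_neg]
        simpa using hn1.trans_lt hsmall
      exact (zpow_lt_zpow_iff_right₀ hq1).1 h1
    obtain ⟨t, ht⟩ : ∃ t : ℕ, n = -(m + t + 2) := ⟨(-m - 2 - n).toNat, by omega⟩
    have ht1 : ((q : ℝ) ^ (m + t + 1 + 1))⁻¹ ≤ ρ := by
      rwa [← zpow_neg, show -(m + t + 1 + 1) = n by omega]
    have ht2 : ρ < ((q : ℝ) ^ (m + t + 1))⁻¹ := by
      rwa [← zpow_neg, show -(m + t + 1) = n + 1 by omega]
    have mem : ∀ y ∈ pivotSide q m k σ, |y - pivot q m k| ≤ ρ → y ∈ flankSet q m k σ t := by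
      intro y hy hyρ
      by_contra hc
      exact absurd (le_abs_sub_pivot hq0 hy hc) (not_le.2 (hyρ.trans_lt ht2))
    have hx2 : x ∉ flankSet q m k σ (t + 2) := fun hx2 => by
      have h1 := abs_sub_pivot_le hq0 hx2
      rw [hxρ] at h1
      have h2 := ht1.trans h1
      rw [inv_zpow_scale_le_iff h.two_le] at h2
      push_cast at h2
      omega
    have hw := h.mul_partialDensity_le (α := α) hx hx2
    have hwpos := h.blockDensity_pos (m := m) (k := k) (α := α) x
    refine (measure_mono fun y hy => mem y (hA hy) (hAρ y hy)).trans ?_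
    rw [h.blockMeasure_flankSet (mem x hx hxρ.le), scale_succ]
    apply ENNReal.ofReal_le_ofReal
    have hP : partialDensity q a b m k α (min t (2 * α - 1)) x ≤
        blockDensity q a b m k α x / a ^ 2 := by
      rw [le_div_iff₀ (by positivity)]; linarith
    calc _ ≤ blockDensity q a b m k α x / a ^ 2 * (q * ρ) := by gcongr
      _ = q / a ^ 2 * (ρ * blockDensity q a b m k α x) := by ring
      _ ≤ _ := by
        gcongr
        linarith

theorem prod_range_weight (β : ℕ) (σ : Bool) (u : ℝ) (v : ℝ) :
    ∏ i ∈ Finset.range β, (if (i + 2 ≤ β + 1 ↔ σ = true) then u else v) =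
      (if σ then u else v) ^ β := by
  rw [Finset.prod_congr rfl (g := fun _ => if σ then u else v), Finset.prod_const,
    Finset.card_range]
  intro i hi
  have : i + 2 ≤ β + 1 := by have := Finset.mem_range.1 hi; omega
  simp [this]

theorem partialDensity_middle {β : ℕ} (hq : 2 ≤ q) {σ : Bool} {x : ℝ}
    (hx : x ∈ flankSet q m k σ β) :
    partialDensity q a b m k (β + 1) β x = (if σ then b else a) ^ (β + 1) := by
  rw [partialDensity_of_mem_flankSet hq hx, prod_range_weight, pow_succ']

theorem partialDensity_middle_succ {β : ℕ} (hq : 2 ≤ q) {x : ℝ}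
    (hx : x ∈ flankSet q m k true (β + 1)) :
    partialDensity q a b m k (β + 1) (β + 1) x = b ^ (β + 1) * a := by
  rw [partialDensity_succ, stepWeight_of_mem_flankSet_succ hq hx,
    partialDensity_middle hq (flankSet_succ_subset (by omega) _ _ hx)]
  simp

/-- The density is constant next to the pivot. -/
theorem blockDensity_core {β : ℕ} (hq : 2 ≤ q) {σ : Bool} {x : ℝ}
    (hx : x ∈ flankSet q m k σ (2 * β + 1)) :
    blockDensity q a b m k (β + 1) x = (a * b) ^ (β + 1) := by
  rw [blockDensity_eq, show 2 * (β + 1) - 1 = 2 * β + 1 by omega,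
    partialDensity_of_mem_flankSet hq hx, show 2 * β + 1 = β + (β + 1) by ring,
    Finset.prod_range_add, prod_range_weight,
    Finset.prod_congr (g := fun _ => if σ then a else b) rfl, Finset.prod_const, Finset.card_range]
  · cases σ <;> simp <;> ring
  · intro i _
    have : ¬ (β + i + 2 ≤ β + 1) := by omega
    cases σ <;> simp [this]

end IsWeightPair

end

section

variable {q : ℕ} {a b : ℝ} {m k : ℤ} {α : ℕ}

/-- The constant in the `p`-adic doubling condition for the measures `blockMeasure`. -/
noncomputable def blockConst (p q : ℕ) (a b : ℝ) : ℝ :=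
  4 * (b / a) ^ (4 * p + 3) * (3 * q / a ^ 3)

namespace IsWeightPair

theorem one_le_mass_factor (h : IsWeightPair q a b) : 1 ≤ 3 * q / a ^ 3 := by
  have h2 : (2 : ℝ) ≤ q := by exact_mod_cast h.two_le
  have h3 : a ^ 3 ≤ 1 := pow_le_one₀ h.pos.le h.lt_one.le
  rw [le_div_iff₀ (pow_pos h.pos 3)]
  linarith

theorem blockConst_ge (h : IsWeightPair q a b) (p : ℕ) :
    4 * (b / a) ^ (4 * p + 3) ≤ blockConst p q a b ∧ 4 * (3 * q / a ^ 3) ≤ blockConst p q a b ∧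
      4 ≤ blockConst p q a b := by
  have h1 := h.one_le_mass_factor
  have h2 : 1 ≤ (b / a) ^ (4 * p + 3) := one_le_pow₀ h.one_le_ratio
  unfold blockConst
  refine ⟨?_, ?_, ?_⟩ <;> nlinarith

theorem blockMeasure_comparable (h : IsWeightPair q a b) {p : ℕ} {σ : Bool} {x V : ℝ} {K : Set ℝ}
    (hK : MeasurableSet K) (hV : volume K = ENNReal.ofReal V) (hx : x ∈ pivotSide q m k σ)
    (hKs : K ⊆ pivotSide q m k σ)
    (h1 : ∀ y ∈ K, |x - pivot q m k| ≤ 4 * p * |y - pivot q m k|)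
    (h2 : ∀ y ∈ K, |y - pivot q m k| ≤ 4 * p * |x - pivot q m k|) :
    ENNReal.ofReal (blockDensity q a b m k α x * V / (b / a) ^ (4 * p + 3)) ≤
        blockMeasure q a b m k α K ∧
      blockMeasure q a b m k α K ≤
        ENNReal.ofReal ((b / a) ^ (4 * p + 3) * (blockDensity q a b m k α x * V)) := by
  have hR : (4 * p : ℝ) ≤ (q : ℝ) ^ (4 * p) := by
    have : 4 * p ≤ q ^ (4 * p) := (Nat.lt_pow_self h.two_le).le
    exact_mod_cast this
  have hw := h.blockDensity_pos (m := m) (k := k) (α := α) x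
  have hΓ : 0 < (b / a) ^ (4 * p + 3) := pow_pos (by linarith [h.one_le_ratio]) _
  have cmp : ∀ u v : ℝ, |u| ≤ 4 * p * |v| → |u| ≤ (q : ℝ) ^ (4 * p) * |v| := fun u v huv =>
    huv.trans (mul_le_mul_of_nonneg_right hR (abs_nonneg _))
  constructor
  · rw [mul_div_right_comm, ENNReal.ofReal_mul (by positivity), ← hV]
    refine le_blockMeasure hK fun y hy => ?_
    rw [div_le_iff₀' hΓ]
    exact h.blockDensity_le_mul hx (hKs hy) (cmp _ _ (h1 y hy)) (cmp _ _ (h2 y hy))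
  · rw [← mul_assoc, ENNReal.ofReal_mul (by positivity), ← hV]
    exact blockMeasure_le hK fun y hy =>
      h.blockDensity_le_mul (hKs hy) hx (cmp _ _ (h2 y hy)) (cmp _ _ (h1 y hy))

theorem blockDensity_core_Ico {β : ℕ} (hq : 2 ≤ q) {x : ℝ}
    (hx : x ∈ Ico (pivot q m k - ((q : ℝ) ^ (m + (2 * β + 1 : ℕ) + 1))⁻¹)
      (pivot q m k + ((q : ℝ) ^ (m + (2 * β + 1 : ℕ) + 1))⁻¹)) :
    blockDensity q a b m k (β + 1) x = (a * b) ^ (β + 1) := by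
  rcases le_or_gt (pivot q m k) x with hx' | hx'
  · exact blockDensity_core (σ := true) hq (by rw [flankSet_true (by omega)]; exact ⟨hx', hx.2⟩)
  · exact blockDensity_core (σ := false) hq (by rw [flankSet_false (by omega)]; exact ⟨hx.1, hx'⟩)

/-- The `p` parts of an interval that lies in a grid are comparable if some grid point is very
close to the pivot. -/
theorem exists_mass_Ico (h : IsWeightPair q a b) {p β : ℕ} (hp : 2 ≤ p) {δ s : ℝ} (hδ : 0 < δ)
    (hs : 0 < s) (hδ' : 20 * p * δ ≤ ((q : ℝ) ^ (m + (2 * β + 1 : ℕ) + 1))⁻¹) (g : ℤ) :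
    ∃ M : ℝ, 0 < M ∧ ∀ i : ℕ, i < p → ∀ K : Set ℝ,
      K = Ico (pivot q m k + δ + (p * g + i) * s) (pivot q m k + δ + (p * g + i + 1) * s) →
      ENNReal.ofReal (M / blockConst p q a b) ≤ blockMeasure q a b m k (β + 1) K ∧
        blockMeasure q a b m k (β + 1) K ≤ ENNReal.ofReal (blockConst p q a b * M) := by
  obtain ⟨hC1, hC2, hC4⟩ := h.blockConst_ge p
  set C := blockConst p q a b with hC
  set Z := pivot q m k with hZ
  set κ := ((q : ℝ) ^ (m + (2 * β + 1 : ℕ) + 1))⁻¹ with hκ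
  set Γ := (b / a) ^ (4 * p + 3) with hΓ
  set B := 3 * q / a ^ 3 with hB
  have hΓ1 : 1 ≤ Γ := one_le_pow₀ h.one_le_ratio
  have hB1 : 1 ≤ B := h.one_le_mass_factor
  have hp' : (2 : ℝ) ≤ p := by exact_mod_cast hp
  have hpδ : 40 * δ ≤ κ := by nlinarith
  have hw := h.blockDensity_pos (m := m) (k := k) (α := β + 1)
  set L := p * s with hL
  have hL0 : 0 < L := by positivity
  have h2s : 2 * s ≤ L := by nlinarith
  have vol : ∀ u v : ℝ, volume (Ico u v) = ENNReal.ofReal (v - u) := fun u v => Real.volume_Ico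
  -- a sufficient condition for the conclusion, for a mass of the form `w * s`
  have fin : ∀ (w : ℝ) (K : Set ℝ), 0 < w →
      (∃ c, 1 ≤ 4 * Γ * c ∧ ENNReal.ofReal (c * (w * s)) ≤ blockMeasure q a b m k (β + 1) K) →
      (∃ d, d ≤ C ∧ blockMeasure q a b m k (β + 1) K ≤ ENNReal.ofReal (d * (w * s))) →
      ENNReal.ofReal (w * s / C) ≤ blockMeasure q a b m k (β + 1) K ∧
        blockMeasure q a b m k (β + 1) K ≤ ENNReal.ofReal (C * (w * s)) := by
    rintro w K hw ⟨c, hc, hc'⟩ ⟨d, hd, hd'⟩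
    have hws : 0 < w * s := by positivity
    constructor
    · refine le_trans (ENNReal.ofReal_le_ofReal ?_) hc'
      rw [div_le_iff₀ (by linarith)]
      have hcpos : 0 < c := by
        by_contra! hc0
        nlinarith
      have : 1 ≤ c * C := by nlinarith
      nlinarith
    · exact hd'.trans (ENNReal.ofReal_le_ofReal (by gcongr))
  -- children away from the pivot
  have away : ∀ (σ : Bool) (x u v : ℝ), v = u + s → x ∈ pivotSide q m k σ →
      (∀ y ∈ Ico u v, y ∈ pivotSide q m k σ ∧ |x - Z| ≤ 4 * p * |y - Z| ∧
        |y - Z| ≤ 4 * p * |x - Z|) →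
      ENNReal.ofReal (blockDensity q a b m k (β + 1) x * s / C) ≤
          blockMeasure q a b m k (β + 1) (Ico u v) ∧
        blockMeasure q a b m k (β + 1) (Ico u v) ≤
          ENNReal.ofReal (C * (blockDensity q a b m k (β + 1) x * s)) := by
    intro σ x u v huv hx hy
    have := h.blockMeasure_comparable (p := p) (α := β + 1) (K := Ico u v) (V := s)
      measurableSet_Ico
      (by rw [vol, huv]; congr 1; ring) hx (fun y hy' => (hy y hy').1)
      (fun y hy' => (hy y hy').2.1) (fun y hy' => (hy y hy').2.2)
    refine fin _ _ (hw x) ⟨1 / Γ, ?_, ?_⟩ ⟨Γ, by linarith, this.2⟩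
    · field_simp; norm_num
    · refine le_of_eq_of_le ?_ this.1
      congr 1
      ring
  -- the lower bound for the child next to the pivot
  have lower : ∀ (σ : Bool) (x u v : ℝ) (K : Set ℝ), v = u + s / 2 → Ico u v ⊆ K →
      x ∈ pivotSide q m k σ →
      (∀ y ∈ Ico u v, y ∈ pivotSide q m k σ ∧ |x - Z| ≤ 4 * p * |y - Z| ∧
        |y - Z| ≤ 4 * p * |x - Z|) →
      ∃ c, 1 ≤ 4 * Γ * c ∧ ENNReal.ofReal (c * (blockDensity q a b m k (β + 1) x * s)) ≤
        blockMeasure q a b m k (β + 1) K := by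
    intro σ x u v K huv hK hx hy
    have := h.blockMeasure_comparable (p := p) (α := β + 1) (K := Ico u v) (V := s / 2)
      measurableSet_Ico
      (by rw [vol, huv]; congr 1; ring) hx (fun y hy' => (hy y hy').1)
      (fun y hy' => (hy y hy').2.1) (fun y hy' => (hy y hy').2.2)
    refine ⟨1 / (2 * Γ), by field_simp; norm_num,
      (le_of_eq_of_le ?_ this.1).trans (measure_mono hK)⟩
    congr 1
    ring
  have ends : ∀ i : ℕ, i < p → 0 ≤ i * s ∧ i * s + s ≤ L := fun i hi => by
    have : (i : ℝ) + 1 ≤ p := by exact_mod_cast hi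
    constructor
    · positivity
    · nlinarith
  have endl : ∀ i : ℕ, Z + δ + (p * g + i) * s = Z + δ + g * L + i * s := fun i => by
    rw [hL]; ring
  have endr : ∀ i : ℕ, Z + δ + (p * g + i + 1) * s = Z + δ + g * L + i * s + s := fun i => by
    rw [hL]; ring
  simp only [endl, endr]
  have inR : ∀ x, Z ≤ x → x ∈ pivotSide q m k true := fun x hx => hx
  have inL : ∀ x, x < Z → x ∈ pivotSide q m k false := fun x hx => hx
  have le8 : ∀ u v : ℝ, 0 ≤ v → u ≤ 8 * v → u ≤ 4 * p * v := fun u v hv huv =>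
    huv.trans (mul_le_mul_of_nonneg_right (by linarith) hv)
  have leL : ∀ u v : ℝ, u ≤ 2 * L → s ≤ 2 * v → u ≤ 4 * p * v := fun u v hu hv => by
    have := mul_le_mul_of_nonneg_left hv (show (0 : ℝ) ≤ 2 * p by positivity)
    linarith
  by_cases hcore : Z - κ ≤ Z + δ + g * L ∧ Z + δ + g * L + L ≤ Z + κ
  · refine ⟨(a * b) ^ (β + 1) * s, by have := h.pos; have := h.b_pos; positivity, ?_⟩
    rintro i hi K rfl
    obtain ⟨e1, e2⟩ := ends i hi
    have hab : 0 < (a * b) ^ (β + 1) := by have := h.pos; have := h.b_pos; positivity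
    have := blockMeasure_eq_of_forall (q := q) (a := a) (b := b) (m := m) (k := k) (α := β + 1)
      (A := Ico (Z + δ + g * L + i * s) (Z + δ + g * L + i * s + s)) (c := (a * b) ^ (β + 1))
      measurableSet_Ico fun x hx => blockDensity_core_Ico h.two_le
        ⟨by linarith [hx.1, hcore.1], by linarith [hx.2, hcore.2]⟩
    rw [vol, add_sub_cancel_left, ← ENNReal.ofReal_mul hab.le] at this
    exact fin _ _ hab ⟨1, by linarith, by rw [this, one_mul]⟩
      ⟨1, by linarith, by rw [this, one_mul]⟩
  rcases lt_trichotomy g 0 with hg | rfl | hg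
  · -- to the left of the pivot
    have hfar : κ + δ < -(g * L) := by
      rw [not_and_or, not_le, not_le] at hcore
      have : (g : ℝ) + 1 ≤ 0 := by exact_mod_cast hg
      rcases hcore with hc | hc
      · linarith
      · nlinarith
    rcases (show g = -1 ∨ g ≤ -2 by omega) with rfl | hg2
    · push_cast at hfar ⊢
      have hsδ : 20 * δ < s := by
        have : p * (20 * δ) < p * s := by linarith
        exact lt_of_mul_lt_mul_left this (by positivity)
      refine ⟨blockDensity q a b m k (β + 1) (Z - s) * s, mul_pos (hw _) hs, ?_⟩
      rintro i hi K rfl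
      obtain ⟨e1, e2⟩ := ends i hi
      have hxabs : |Z - s - Z| = s := by rw [abs_of_neg] <;> linarith
      rcases (show i + 1 < p ∨ i + 1 = p by omega) with hi' | hi'
      · have e3 := (ends (i + 1) hi').2
        push_cast at e3
        refine away false _ _ _ rfl (inL _ (by linarith)) fun y hy => ?_
        have h1 := hy.1
        have h2 := hy.2
        have hyabs : |y - Z| = Z - y := by rw [abs_of_neg] <;> linarith
        refine ⟨inL _ (by linarith), ?_, ?_⟩ <;> rw [hxabs, hyabs]
        · exact le8 _ _ (by linarith) (by linarith)
        · exact leL _ _ (by linarith) (by linarith)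
      · have e4 : (i : ℝ) * s = L - s := by
          rw [hL, ← hi']; push_cast; ring
        rw [e4]
        refine fin _ _ (hw _) ?_ ⟨4 * B, hC2, ?_⟩
        · refine lower false _ (Z - 3 / 4 * s) (Z - s / 4) _ (by ring)
            (Ico_subset_Ico (by linarith) (by linarith)) (inL _ (by linarith)) fun y hy => ?_
          have h1 := hy.1
          have h2 := hy.2
          have hyabs : |y - Z| = Z - y := by rw [abs_of_neg] <;> linarith
          refine ⟨inL _ (by linarith), ?_, ?_⟩ <;> rw [hxabs, hyabs]
          · exact le8 _ _ (by linarith) (by linarith)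
          · exact le8 _ _ (by linarith) (by linarith)
        · have key := h.blockMeasure_le_of_near (α := β + 1) (A := Ico (Z - s) Z)
            measurableSet_Ico (inL (Z - s) (by linarith)) hs hxabs (fun y hy => inL _ hy.2)
            fun y hy => by rw [abs_of_neg] <;> linarith [hy.1, hy.2]
          have c1 := blockMeasure_eq_of_forall (q := q) (a := a) (b := b) (m := m) (k := k)
            (α := β + 1) (A := Ico Z (Z + δ)) (c := (a * b) ^ (β + 1))
            measurableSet_Ico fun x hx => blockDensity_core_Ico h.two_le
              ⟨by linarith [hx.1], by linarith [hx.2]⟩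
          have c2 := blockMeasure_eq_of_forall (q := q) (a := a) (b := b) (m := m) (k := k)
            (α := β + 1) (A := Ico (Z - δ) Z) (c := (a * b) ^ (β + 1))
            measurableSet_Ico fun x hx => blockDensity_core_Ico h.two_le
              ⟨by linarith [hx.1], by linarith [hx.2]⟩
          rw [vol, show Z + δ - Z = Z - (Z - δ) by ring, ← vol, ← c2] at c1
          calc blockMeasure q a b m k (β + 1) _
              ≤ blockMeasure q a b m k (β + 1) (Ico (Z - s) Z ∪ Ico Z (Z + δ)) :=
                measure_mono fun y hy => by
                  rcases lt_or_ge y Z with hyZ | hyZ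
                  · exact Or.inl ⟨by linarith [hy.1], hyZ⟩
                  · exact Or.inr ⟨hyZ, by linarith [hy.2]⟩
            _ ≤ _ := measure_union_le _ _
            _ ≤ blockMeasure q a b m k (β + 1) (Ico (Z - s) Z) +
                blockMeasure q a b m k (β + 1) (Ico (Z - s) Z) := by
              rw [c1]
              gcongr
              linarith
            _ ≤ _ := add_le_add key key
            _ ≤ _ := by
              have := hw (Z - s)
              rw [← ENNReal.ofReal_add (by positivity) (by positivity)]
              apply ENNReal.ofReal_le_ofReal
              have : 0 < B * (blockDensity q a b m k (β + 1) (Z - s) * s) := by positivity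
              nlinarith
    · have hg' : (g : ℝ) ≤ -2 := by exact_mod_cast hg2
      have hgL : L ≤ -(g * L) / 2 := by nlinarith
      refine ⟨blockDensity q a b m k (β + 1) (Z + δ + g * L) * s, mul_pos (hw _) hs, ?_⟩
      rintro i hi K rfl
      obtain ⟨e1, e2⟩ := ends i hi
      have hxabs : |Z + δ + g * L - Z| = -(g * L) - δ := by rw [abs_of_neg] <;> linarith
      refine away false _ _ _ rfl (inL _ (by linarith)) fun y hy => ?_
      have h1 := hy.1
      have h2 := hy.2
      have hyabs : |y - Z| = Z - y := by rw [abs_of_neg] <;> linarith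
      refine ⟨inL _ (by linarith), ?_, ?_⟩ <;> rw [hxabs, hyabs]
      · exact le8 _ _ (by linarith) (by linarith)
      · exact le8 _ _ (by linarith) (by linarith)
  · -- the interval begins next to the pivot
    simp only [Int.cast_zero, zero_mul, add_zero, not_and_or, not_le] at hcore ⊢
    have hsδ : δ < s := by
      have : p * δ < p * s := by
        rcases hcore with hc | hc
        · linarith
        · nlinarith
      exact lt_of_mul_lt_mul_left this (by positivity)
    refine ⟨blockDensity q a b m k (β + 1) (Z + δ + s) * s, mul_pos (hw _) hs, ?_⟩
    rintro i hi K rfl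
    obtain ⟨e1, e2⟩ := ends i hi
    have hxabs : |Z + δ + s - Z| = s + δ := by
        rw [abs_of_pos (by linarith)]; ring
    rcases Nat.eq_zero_or_pos i with rfl | hi0
    · simp only [Nat.cast_zero, zero_mul, add_zero]
      refine fin _ _ (hw _) ?_ ⟨2 * B, by linarith, ?_⟩
      · refine lower true _ (Z + δ + s / 2) (Z + δ + s) _ (by ring)
          (Ico_subset_Ico (by linarith) le_rfl) (inR _ (by linarith)) fun y hy => ?_
        have h1 := hy.1
        have h2 := hy.2
        have hyabs : |y - Z| = y - Z := abs_of_pos (by linarith)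
        refine ⟨inR _ (by linarith), ?_, ?_⟩ <;> rw [hxabs, hyabs]
        · exact le8 _ _ (by linarith) (by linarith)
        · exact le8 _ _ (by linarith) (by linarith)
      · refine (h.blockMeasure_le_of_near (α := β + 1) (x := Z + δ + s) (ρ := s + δ)
          measurableSet_Ico (inR _ (by linarith)) (by linarith) hxabs
          (fun y hy => inR _ (by linarith [hy.1]))
          fun y hy => by rw [abs_of_pos] <;> linarith [hy.1, hy.2]).trans
          (ENNReal.ofReal_le_ofReal ?_)
        have := hw (Z + δ + s)
        calc B * ((s + δ) * blockDensity q a b m k (β + 1) (Z + δ + s))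
            ≤ B * ((s + s) * blockDensity q a b m k (β + 1) (Z + δ + s)) := by gcongr
          _ = _ := by ring
    · have hi1 : s ≤ i * s := le_mul_of_one_le_left hs.le (by exact_mod_cast hi0)
      refine away true _ _ _ rfl (inR _ (by linarith)) fun y hy => ?_
      have h1 := hy.1
      have h2 := hy.2
      have hyabs : |y - Z| = y - Z := abs_of_pos (by linarith)
      refine ⟨inR _ (by linarith), ?_, ?_⟩ <;> rw [hxabs, hyabs]
      · exact le8 _ _ (by linarith) (by linarith)
      · exact leL _ _ (by linarith) (by linarith)
  · have hg1 : (1 : ℝ) ≤ g := by exact_mod_cast hg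
    have hgL : L ≤ g * L := le_mul_of_one_le_left hL0.le hg1
    refine ⟨blockDensity q a b m k (β + 1) (Z + δ + g * L + L) * s, mul_pos (hw _) hs, ?_⟩
    rintro i hi K rfl
    obtain ⟨e1, e2⟩ := ends i hi
    have hxabs : |Z + δ + g * L + L - Z| = g * L + L + δ := by
        rw [abs_of_pos (by linarith)]; ring
    refine away true _ _ _ rfl (inR _ (by linarith)) fun y hy => ?_
    have h1 := hy.1
    have h2 := hy.2
    have hyabs : |y - Z| = y - Z := abs_of_pos (by linarith)
    refine ⟨inR _ (by linarith), ?_, ?_⟩ <;> rw [hxabs, hyabs]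
    · exact le8 _ _ (by linarith) (by linarith)
    · exact le8 _ _ (by linarith) (by linarith)

end IsWeightPair

end

theorem isAdicDoublingOn_univ_of_exists_mass {n : ℕ} {μ : Measure ℝ} {C : ℝ} (hC : 0 < C)
    (h : ∀ m k : ℤ, ∃ M : ℝ, 0 < M ∧ ∀ i < n, ENNReal.ofReal (M / C) ≤ μ (adicChild n m k i) ∧
      μ (adicChild n m k i) ≤ ENNReal.ofReal (C * M)) : IsAdicDoublingOn univ n μ := by
  refine ⟨C ^ 2, by positivity, fun m k _ => ?_⟩
  obtain ⟨M, hM, hμ⟩ := h m k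
  have hfin : ∀ i < n, μ (adicChild n m k i) < ∞ := fun i hi =>
    (hμ i hi).2.trans_lt ENNReal.ofReal_lt_top
  have lo : ∀ i < n, M / C ≤ μ.real (adicChild n m k i) := fun i hi =>
    (ENNReal.ofReal_le_iff_le_toReal (hfin i hi).ne).1 (hμ i hi).1
  have hi' : ∀ i < n, μ.real (adicChild n m k i) ≤ C * M := fun i hi =>
    ENNReal.toReal_le_of_le_ofReal (by positivity) (hμ i hi).2
  have hMC : 0 < M / C := by positivity
  refine ⟨fun j hj => ⟨lt_of_lt_of_le (ENNReal.ofReal_pos.2 hMC) (hμ j hj).1, hfin j hj⟩,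
    fun i hi j hj => ?_⟩
  have hj0 := hMC.trans_le (lo j hj)
  constructor
  · rw [le_div_iff₀ hj0]
    calc 1 / C ^ 2 * μ.real (adicChild n m k j) ≤ 1 / C ^ 2 * (C * M) := by
          gcongr; exact hi' j hj
      _ = M / C := by field_simp
      _ ≤ _ := lo i hi
  · rw [div_le_iff₀ hj0]
    calc μ.real (adicChild n m k i) ≤ C * M := hi' i hi
      _ = C ^ 2 * (M / C) := by field_simp
      _ ≤ _ := by gcongr; exact lo j hj

section

variable {q : ℕ} {a b : ℝ} {m k : ℤ} {α : ℕ}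

namespace IsWeightPair

theorem exists_mass_adicChild_self (h : IsWeightPair q a b) (m k : ℤ) (α : ℕ) (r k' : ℤ) :
    ∃ M : ℝ, 0 < M ∧ ∀ i < q,
      ENNReal.ofReal (M / (b / a)) ≤ blockMeasure q a b m k α (adicChild q r k' i) ∧
      blockMeasure q a b m k α (adicChild q r k' i) ≤ ENNReal.ofReal (b / a * M) := by
  have ha := h.pos
  have hb := h.b_pos
  have hq' : (0 : ℝ) < q := by exact_mod_cast h.q_pos
  have hΓ := h.one_le_ratio
  rcases lt_or_ge r m with hr | hr
  · have hM : 0 < ((q : ℝ) ^ (r + 1))⁻¹ := by positivity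
    refine ⟨((q : ℝ) ^ (r + 1))⁻¹, hM, fun i _ => ?_⟩
    rw [adicChild, h.blockMeasure_adicInterval_of_le (by omega), volume_adicInterval]
    exact ⟨ENNReal.ofReal_le_ofReal (div_le_self hM.le hΓ),
      ENNReal.ofReal_le_ofReal (le_mul_of_one_le_left hM.le hΓ)⟩
  obtain ⟨j, rfl⟩ := Int.le.dest hr
  have hη : 0 < ((q : ℝ) ^ (m + j + 1))⁻¹ := by positivity
  obtain ⟨c, hc, hc'⟩ : ∃ c : ℝ, 0 < c ∧ ∀ x ∈ adicInterval q (m + j) k',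
      partialDensity q a b m k α (min j (2 * α - 1)) x ∈ Icc (a * c) (b * c) := by
    rcases j with _ | t
    · refine ⟨1, one_pos, fun x _ => ?_⟩
      rw [zero_min, partialDensity, Finset.range_zero, Finset.prod_empty, mul_one, mul_one, mul_one]
      exact childWeight_mem_Icc h.lt_one.le h.one_lt.le _ _ _ _
    · set x₀ := (k' : ℝ) / (q : ℝ) ^ (m + (t + 1 : ℕ)) with hx₀
      have hx₀' : x₀ ∈ adicInterval q (m + (t + 1 : ℕ)) k' := by
        rw [adicInterval_eq_Ico, left_mem_Ico, lt_add_iff_pos_right]; positivity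
      refine ⟨partialDensity q a b m k α (min t (2 * α - 1)) x₀, h.partialDensity_pos _ _,
        fun x hx => ?_⟩
      have hP0 := h.partialDensity_pos (m := m) (k := k) (α := α) (min t (2 * α - 1)) x
      rw [← partialDensity_congr h.q_pos (by push_cast; omega) hx hx₀']
      rcases le_or_gt (2 * α - 1) t with hJ | hJ
      · rw [min_eq_right hJ] at hP0 ⊢
        rw [min_eq_right (hJ.trans t.le_succ)]
        constructor <;> nlinarith [h.lt_one, h.one_lt]
      · rw [min_eq_left hJ.le] at hP0 ⊢
        rw [min_eq_left hJ, partialDensity_succ, mul_comm _ (stepWeight _ _ _ _ _ _ _ _)]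
        have := stepWeight_mem_Icc (m := m) (k := k) (α := α) h.q_pos h.lt_one.le h.one_lt.le t x
        exact ⟨mul_le_mul_of_nonneg_right this.1 hP0.le, mul_le_mul_of_nonneg_right this.2 hP0.le⟩
  refine ⟨c * ((q : ℝ) ^ (m + j + 1))⁻¹, by positivity, fun i hi => ?_⟩
  have hmem : ((q * k' + i : ℤ) : ℝ) / (q : ℝ) ^ (m + j + 1) ∈ adicChild q (m + j) k' i := by
    rw [adicChild, adicInterval_eq_Ico, left_mem_Ico, lt_add_iff_pos_right]; positivity
  have hcc := hc' _ (adicChild_subset hi hmem)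
  rw [adicChild, h.blockMeasure_adicInterval hmem]
  constructor
  · refine ENNReal.ofReal_le_ofReal ?_
    calc _ = a / b * c * ((q : ℝ) ^ (m + j + 1))⁻¹ := by field_simp
      _ ≤ a * c * ((q : ℝ) ^ (m + j + 1))⁻¹ := by gcongr; exact div_le_self ha.le h.one_lt.le
      _ ≤ _ := by gcongr; exact hcc.1
  · refine ENNReal.ofReal_le_ofReal ?_
    calc _ ≤ b * c * ((q : ℝ) ^ (m + j + 1))⁻¹ := by gcongr; exact hcc.2
      _ ≤ b / a * c * ((q : ℝ) ^ (m + j + 1))⁻¹ := by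
        gcongr; exact (le_div_iff₀ ha).2 (by nlinarith [h.lt_one])
      _ = _ := by ring

/-- The measure of a set that is long compared with the block. -/
theorem blockMeasure_Ico_bounds (h : IsWeightPair q a b) {u v : ℝ}
    (huv : 2 * ((q : ℝ) ^ m)⁻¹ ≤ v - u) :
    ENNReal.ofReal ((v - u) / 2) ≤ blockMeasure q a b m k α (Ico u v) ∧
      blockMeasure q a b m k α (Ico u v) ≤ ENNReal.ofReal (2 * (v - u)) := by
  have hq' : (0 : ℝ) < q := by exact_mod_cast h.q_pos
  have hη : 0 < ((q : ℝ) ^ m)⁻¹ := by positivity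
  set I := adicInterval q m k with hI
  have hIm : MeasurableSet I := measurableSet_adicInterval
  have hνI : blockMeasure q a b m k α I = ENNReal.ofReal ((q : ℝ) ^ m)⁻¹ := by
    rw [h.blockMeasure_adicInterval_of_le le_rfl, volume_adicInterval]
  have hoff : blockMeasure q a b m k α (Ico u v \ I) = volume (Ico u v \ I) := by
    rw [blockMeasure_eq_of_forall (c := 1) (measurableSet_Ico.diff hIm) fun x hx => ?_]
    · simp
    · rw [blockDensity_eq, partialDensity_of_notMem h.two_le hx.2]
  constructor
  · calc ENNReal.ofReal ((v - u) / 2) ≤ ENNReal.ofReal ((v - u) - ((q : ℝ) ^ m)⁻¹) :=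
        ENNReal.ofReal_le_ofReal (by linarith)
      _ = volume (Ico u v) - volume I := by
        rw [Real.volume_Ico, hI, volume_adicInterval, ENNReal.ofReal_sub _ hη.le]
      _ ≤ volume (Ico u v \ I) := le_measure_sdiff
      _ ≤ _ := hoff.symm.le.trans (measure_mono sdiff_subset)
  · calc blockMeasure q a b m k α (Ico u v)
        ≤ blockMeasure q a b m k α ((Ico u v \ I) ∪ I) := measure_mono (by simp)
      _ ≤ _ := measure_union_le _ _
      _ ≤ volume (Ico u v) + ENNReal.ofReal ((q : ℝ) ^ m)⁻¹ := by
        rw [hνI, hoff]; gcongr; exact sdiff_subset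
      _ ≤ _ := by
        rw [Real.volume_Ico, ← ENNReal.ofReal_add (by linarith) hη.le]
        exact ENNReal.ofReal_le_ofReal (by linarith)

/-- Doubling with respect to a base for which some grid point is very close to the pivot. -/
theorem exists_mass_adicChild (h : IsWeightPair q a b) {p β n : ℕ} (hp : 2 ≤ p) {y : ℤ} {δ : ℝ}
    (hδ : 0 < δ) (hy : (y : ℝ) / (p : ℝ) ^ n = pivot q m k + δ)
    (hδ' : 20 * p * δ ≤ ((q : ℝ) ^ (m + (2 * β + 1 : ℕ) + 1))⁻¹)
    (hn : 2 * ((q : ℝ) ^ m)⁻¹ ≤ ((p : ℝ) ^ n)⁻¹) (N j : ℤ) :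
    ∃ M : ℝ, 0 < M ∧ ∀ i < p,
      ENNReal.ofReal (M / blockConst p q a b) ≤
        blockMeasure q a b m k (β + 1) (adicChild p N j i) ∧
      blockMeasure q a b m k (β + 1) (adicChild p N j i) ≤
        ENNReal.ofReal (blockConst p q a b * M) := by
  have hp' : (0 : ℝ) < p := by positivity
  have hp1 : (1 : ℝ) ≤ p := by exact_mod_cast (by omega : 1 ≤ p)
  have hs : 0 < ((p : ℝ) ^ (N + 1))⁻¹ := by positivity
  rcases le_or_gt (n : ℤ) N with hN | hN
  · obtain ⟨d, rfl⟩ := Int.le.dest hN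
    obtain ⟨M, hM, hM'⟩ := h.exists_mass_Ico (m := m) (k := k) hp hδ hs hδ' (j - y * p ^ d)
    refine ⟨M, hM, fun i hi => hM' i hi _ ?_⟩
    have hpow : (p : ℝ) ^ ((n : ℤ) + d + 1) = p ^ n * p ^ d * p := by
      rw [zpow_add_one₀ hp'.ne', zpow_add₀ hp'.ne', zpow_natCast, zpow_natCast]
    rw [adicChild, adicInterval, ← hy, hpow]
    push_cast
    congr 1 <;> field_simp <;> ring
  · have hC := (h.blockConst_ge p).2.2
    have hle : ((p : ℝ) ^ n)⁻¹ ≤ ((p : ℝ) ^ (N + 1))⁻¹ := by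
      apply inv_anti₀ (by positivity)
      rw [← zpow_natCast]
      exact zpow_le_zpow_right₀ hp1 hN
    refine ⟨((p : ℝ) ^ (N + 1))⁻¹, hs, fun i _ => ?_⟩
    rw [adicChild, adicInterval_eq_Ico]
    have key := h.blockMeasure_Ico_bounds (k := k) (α := β + 1) (m := m)
      (u := ((p * j + i : ℤ) : ℝ) / (p : ℝ) ^ (N + 1))
      (v := ((p * j + i : ℤ) : ℝ) / (p : ℝ) ^ (N + 1) + ((p : ℝ) ^ (N + 1))⁻¹) (by linarith)
    rw [add_sub_cancel_left] at key
    constructor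
    · refine le_trans (ENNReal.ofReal_le_ofReal ?_) key.1
      gcongr
      linarith
    · refine key.2.trans (ENNReal.ofReal_le_ofReal ?_)
      gcongr
      linarith

end IsWeightPair

end

section

variable {q : ℕ} {a b : ℝ} {m k : ℕ → ℤ} {α : ℕ → ℕ}

theorem finprod_blockDensity (hq : 2 ≤ q) {l : ℕ} {x : ℝ}
    (hx : ∀ l' ≠ l, x ∉ adicInterval q (m l') (k l')) :
    ∏ᶠ l, blockDensity q a b (m l) (k l) (α l) x = blockDensity q a b (m l) (k l) (α l) x :=
  finprod_eq_single _ l fun l' hl' => by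
    rw [blockDensity_eq, partialDensity_of_notMem hq (hx l' hl')]

theorem reweightedMeasure_eq_of_disjoint (hq : 2 ≤ q) {l : ℕ} {K : Set ℝ} (hK : MeasurableSet K)
    (hKl : ∀ l' ≠ l, Disjoint (adicInterval q (m l') (k l')) K) :
    reweightedMeasure q a b m k α K = blockMeasure q a b (m l) (k l) (α l) K := by
  rw [reweightedMeasure, blockMeasure, withDensity_apply _ hK, withDensity_apply _ hK]
  refine setLIntegral_congr_fun hK fun x hx => ?_
  simp only [finprod_blockDensity hq fun l' hl' => Set.disjoint_right.1 (hKl l' hl') hx]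

/-- Blocks that are not cut by a set do not affect its measure. -/
theorem reweightedMeasure_eq_blockMeasure (h : IsWeightPair q a b)
    (hdisj : Pairwise fun l l' => Disjoint (adicInterval q (m l) (k l))
      (adicInterval q (m l') (k l')))
    (l₀ : ℕ) {K : Set ℝ} (hK : MeasurableSet K)
    (hKl : ∀ l ≠ l₀, adicInterval q (m l) (k l) ⊆ K ∨ Disjoint (adicInterval q (m l) (k l)) K) :
    reweightedMeasure q a b m k α K = blockMeasure q a b (m l₀) (k l₀) (α l₀) K := by
  have hq := h.two_le
  set I : ℕ → Set ℝ := fun l => adicInterval q (m l) (k l) with hI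
  have hIm : ∀ l, MeasurableSet (I l) := fun l => measurableSet_adicInterval
  set U : Set ℝ := ⋃ l : {l // l ≠ l₀}, I l with hU
  have hUm : MeasurableSet U := MeasurableSet.iUnion fun l => hIm l
  rw [← measure_inter_add_sdiff K hUm (μ := reweightedMeasure q a b m k α),
    ← measure_inter_add_sdiff K hUm (μ := blockMeasure q a b (m l₀) (k l₀) (α l₀))]
  congr 1
  · rw [hU, inter_iUnion, measure_iUnion, measure_iUnion]
    · congr 1
      ext ⟨l, hl⟩
      rcases hKl l hl with hlK | hlK
      · rw [inter_eq_self_of_subset_right hlK,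
          reweightedMeasure_eq_of_disjoint hq (l := l) (hIm l) fun l' hl' => hdisj hl',
          h.blockMeasure_adicInterval_of_le le_rfl,
          blockMeasure_eq_of_forall (c := 1) (hIm l) fun x hx => ?_]
        · simp [hI]
        · rw [blockDensity_eq, partialDensity_of_notMem hq]
          exact Set.disjoint_left.1 (hdisj hl) hx
      · rw [inter_comm, hlK.inter_eq, measure_empty, measure_empty]
    · exact fun l l' hll' => (hdisj (Subtype.coe_injective.ne hll')).mono
        inter_subset_right inter_subset_right
    · exact fun l => hK.inter (hIm l)
    · exact fun l l' hll' => (hdisj (Subtype.coe_injective.ne hll')).mono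
        inter_subset_right inter_subset_right
    · exact fun l => hK.inter (hIm l)
  · refine reweightedMeasure_eq_of_disjoint hq (hK.diff hUm) fun l' hl' => ?_
    exact Set.disjoint_left.2 fun x hx hx' => hx'.2 (mem_iUnion.2 ⟨⟨l', hl'⟩, hx⟩)

theorem reweightedMeasure_flankSet (h : IsWeightPair q a b)
    (hdisj : Pairwise fun l l' => Disjoint (adicInterval q (m l) (k l))
      (adicInterval q (m l') (k l')))
    (l j : ℕ) {σ : Bool} {x : ℝ} (hx : x ∈ flankSet q (m l) (k l) σ j) :
    reweightedMeasure q a b m k α (flankSet q (m l) (k l) σ j) =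
      ENNReal.ofReal (partialDensity q a b (m l) (k l) (α l) (min j (2 * α l - 1)) x *
        ((q : ℝ) ^ (m l + j + 1))⁻¹) := by
  rw [reweightedMeasure_eq_of_disjoint h.two_le measurableSet_flankSet, h.blockMeasure_flankSet hx]
  exact fun l' hl' => (hdisj hl').mono_right (flankSet_subset h.two_le σ j)

theorem exists_uncut_adicChild_self (hq : 2 ≤ q)
    (hdisj : Pairwise fun l l' => Disjoint (adicInterval q (m l) (k l))
      (adicInterval q (m l') (k l')))
    (r k' : ℤ) : ∃ l₀, ∀ l ≠ l₀, ∀ i < q,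
      adicInterval q (m l) (k l) ⊆ adicChild q r k' i ∨
        Disjoint (adicInterval q (m l) (k l)) (adicChild q r k' i) := by
  have hq0 : 0 < q := by omega
  by_cases hex : ∃ l, adicInterval q r k' ⊆ adicInterval q (m l) (k l)
  · obtain ⟨l₀, hl₀⟩ := hex
    exact ⟨l₀, fun l hl i hi =>
      Or.inr ((hdisj hl).mono_right ((adicChild_subset hi).trans hl₀))⟩
  · push Not at hex
    refine ⟨0, fun l _ i hi => ?_⟩
    rcases le_or_gt (m l) r with hr | hr
    · rcases adicInterval_subset_or_disjoint hq0 hr (k l) k' with hs | hd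
      · exact absurd hs (hex l)
      · exact Or.inr (hd.symm.mono_right (adicChild_subset hi))
    · exact adicInterval_subset_or_disjoint hq0 hr _ _

/-- An interval of the `p`-adic grid is cut by at most one block at the level of its children, if
the blocks are close to the points `p ^ (-n l)`. -/
theorem exists_uncut_adicChild {p : ℕ} (hp : 2 ≤ p) {n : ℕ → ℤ}
    (hsep : ∀ l l', l ≠ l' → n l + 2 ≤ n l' ∨ n l' + 2 ≤ n l)
    (hI : ∀ l, adicInterval q (m l) (k l) ⊆
      Ico ((p : ℝ) ^ (n l + 1))⁻¹ ((p : ℝ) ^ (n l - 1))⁻¹) (N j : ℤ) :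
    ∃ l₀, ∀ l ≠ l₀, ∀ i < p, adicInterval q (m l) (k l) ⊆ adicChild p N j i ∨
        Disjoint (adicInterval q (m l) (k l)) (adicChild p N j i) := by
  have hp0 : 0 < p := by omega
  have hp' : (0 : ℝ) < p := by exact_mod_cast hp0
  have sub : ∀ l r, r < n l → adicInterval q (m l) (k l) ⊆ adicInterval p r 0 := by
    intro l r hr x hx
    have hx' := hI l hx
    rw [adicInterval_eq_Ico, Int.cast_zero, zero_div, zero_add]
    refine ⟨le_trans (by positivity) hx'.1, hx'.2.trans_le ?_⟩
    rw [inv_zpow_scale_le_iff hp]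
    omega
  have disj : ∀ l r, n l < r → Disjoint (adicInterval q (m l) (k l)) (adicInterval p r 0) := by
    intro l r hr
    rw [Set.disjoint_left]
    intro x hx hx'
    rw [adicInterval_eq_Ico, Int.cast_zero, zero_div, zero_add] at hx'
    refine absurd (hx'.2.trans_le ?_) (not_lt.2 (hI l hx).1)
    rw [inv_zpow_scale_le_iff hp]
    omega
  let cut : ℕ → Prop := fun l => ∃ i < p, ¬ adicInterval q (m l) (k l) ⊆ adicChild p N j i ∧
    ¬ Disjoint (adicInterval q (m l) (k l)) (adicChild p N j i)
  have level : ∀ l, cut l → n l ≤ N + 1 := by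
    rintro l ⟨i, hi, h1, h2⟩
    by_contra! hlt
    have hs := sub l (N + 1) hlt
    by_cases h0 : (p * j + i : ℤ) = 0
    · rw [adicChild, h0] at h1
      exact h1 hs
    · exact h2 ((adicInterval_disjoint hp0 (Ne.symm h0)).mono_left hs)
  have key : ∀ l l', cut l → cut l' → ¬ n l + 2 ≤ n l' := by
    intro l l' hl hl' hn
    have hN := level l' hl'
    obtain ⟨i, hi, -, h2⟩ := hl
    obtain ⟨i', hi', -, h2'⟩ := hl'
    rcases adicInterval_subset_or_disjoint hp0 (show n l + 1 ≤ N by omega) 0 j with hs | hd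
    · exact h2 ((disj l _ (lt_add_one _)).mono_right ((adicChild_subset hi).trans hs))
    · exact h2' ((hd.symm.mono_right (adicChild_subset hi')).mono_left (sub l' _ (by omega)))
  have uncut : ∀ l, ¬ cut l → ∀ i < p, adicInterval q (m l) (k l) ⊆ adicChild p N j i ∨
      Disjoint (adicInterval q (m l) (k l)) (adicChild p N j i) := by
    intro l hl i hi
    by_contra! hc
    exact hl ⟨i, hi, hc.1, hc.2⟩
  by_cases hex : ∃ l, cut l
  · obtain ⟨l₀, hl₀⟩ := hex
    refine ⟨l₀, fun l hl => uncut l fun hc => ?_⟩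
    rcases hsep l l₀ hl with h | h
    · exact key l l₀ hc hl₀ h
    · exact key l₀ l hl₀ hc h
  · push Not at hex
    exact ⟨0, fun l _ => uncut l (hex l)⟩

end

/-- The block with index `m`, `k` has a pivot just to the left of `p ^ (-n)`. -/
structure IsNearGrid (p q n β m k : ℕ) : Prop where
  large : 4 * p ^ (n + 1) ≤ q ^ m
  eq : p ^ n * (q * k + (q - 1)) + 1 = q ^ (m + 1)
  deep : 20 * p * q ^ (2 * β + 1) ≤ p ^ n

theorem exists_isNearGrid {p q n β : ℕ} (hp : p.Prime) (hq : q.Prime) (hqp : q < p)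
    (hdvd : q - 1 ∣ n) (hn : 2 * β + 8 ≤ n) : ∃ m k, IsNearGrid p q n β m k := by
  have hq2 := hq.two_le
  have hcop : Nat.Coprime q p := (Nat.coprime_primes hq hp).2 hqp.ne
  set e := (p ^ n).totient * (4 * p ^ (n + 1) + 1) with he
  have hφ : 0 < (p ^ n).totient := Nat.totient_pos.2 (pow_pos hp.pos n)
  have hle : 4 * p ^ (n + 1) + 1 ≤ e := Nat.le_mul_of_pos_left _ hφ
  obtain ⟨m, hm⟩ : ∃ m, e = m + 1 := ⟨e - 1, by omega⟩
  have h1 : p ^ n ∣ q ^ (m + 1) - 1 := by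
    refine (Nat.modEq_iff_dvd' (Nat.one_le_pow _ _ hq.pos)).1 ?_
    rw [← hm, he, pow_mul]
    simpa using ((Nat.ModEq.pow_totient (hcop.pow_right n)).pow (4 * p ^ (n + 1) + 1)).symm
  obtain ⟨z, hz⟩ := h1
  have hz' : p ^ n * z + 1 = q ^ (m + 1) := by
    have := Nat.one_le_pow (m + 1) q hq.pos
    omega
  have hpn : p ^ n ≡ 1 [MOD q] := by
    obtain ⟨c, rfl⟩ := hdvd
    have := (Nat.ModEq.pow_totient hcop.symm).pow c
    rwa [Nat.totient_prime hq, one_pow, ← pow_mul] at this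
  have hzq : q ∣ z + 1 := by
    have h2 : p ^ n * z + 1 ≡ 1 * z + 1 [MOD q] := (hpn.mul_right z).add_right 1
    rw [hz', one_mul] at h2
    exact (h2.dvd_iff (dvd_refl q)).1 (dvd_pow_self q (by omega))
  obtain ⟨c, hc⟩ := hzq
  obtain ⟨k, rfl⟩ : ∃ k, c = k + 1 := Nat.exists_eq_succ_of_ne_zero (by rintro rfl; omega)
  have hzk : z = q * k + (q - 1) := by rw [mul_add, mul_one] at hc; omega
  refine ⟨m, k, ⟨?_, hzk ▸ hz', ?_⟩⟩
  · have : m < q ^ m := Nat.lt_pow_self hq2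
    omega
  · have hp3 : 3 ≤ p := by omega
    calc 20 * p * q ^ (2 * β + 1) ≤ 3 ^ 6 * p * q ^ (2 * β + 1) := by gcongr; norm_num
      _ ≤ p ^ 6 * p * p ^ (2 * β + 1) := by gcongr
      _ = p ^ (2 * β + 8) := by ring
      _ ≤ p ^ n := Nat.pow_le_pow_right hp.pos hn

namespace IsNearGrid

variable {p q n β m k : ℕ}

theorem inv_eq (h : IsNearGrid p q n β m k) (hp : 0 < p) (hq : 0 < q) :
    ((1 : ℤ) : ℝ) / (p : ℝ) ^ n = pivot q m k + 1 / ((p : ℝ) ^ n * (q : ℝ) ^ (m + 1)) := by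
  have hp' : (p : ℝ) ≠ 0 := by positivity
  have hq' : (q : ℝ) ≠ 0 := by positivity
  have h1 : (p : ℝ) ^ n * (q * k + (q - 1)) + 1 = (q : ℝ) ^ (m + 1) := by
    have := h.eq
    rw [← Nat.cast_inj (R := ℝ)] at this
    simpa [Nat.cast_sub (show 1 ≤ q from hq)] using this
  have h2 : (q : ℝ) ^ ((m : ℤ) + 1) = (q : ℝ) ^ (m + 1) := by
    rw [← zpow_natCast]; push_cast; rfl
  rw [pivot, h2]
  field_simp
  push_cast
  linarith

theorem offset_le (h : IsNearGrid p q n β m k) (hp : 0 < p) (hq : 0 < q) :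
    20 * p * (1 / ((p : ℝ) ^ n * (q : ℝ) ^ (m + 1))) ≤
      ((q : ℝ) ^ ((m : ℤ) + (2 * β + 1 : ℕ) + 1))⁻¹ := by
  have hp' : (0 : ℝ) < p := by exact_mod_cast hp
  have hq' : (0 : ℝ) < q := by exact_mod_cast hq
  have h1 : 20 * (p : ℝ) * (q : ℝ) ^ (2 * β + 1) ≤ (p : ℝ) ^ n := by exact_mod_cast h.deep
  have h2 : (q : ℝ) ^ ((m : ℤ) + (2 * β + 1 : ℕ) + 1) = (q : ℝ) ^ (2 * β + 1) * q ^ (m + 1) := by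
    rw [← pow_add, ← zpow_natCast]; congr 1; push_cast; ring
  rw [h2, mul_one_div, div_le_iff₀ (by positivity), ← div_eq_inv_mul, le_div_iff₀ (by positivity)]
  nlinarith [pow_pos hq' (m + 1)]

theorem four_mul_le (h : IsNearGrid p q n β m k) (hp : 0 < p) (hq : 0 < q) :
    4 * ((q : ℝ) ^ (m : ℤ))⁻¹ ≤ ((p : ℝ) ^ ((n : ℤ) + 1))⁻¹ := by
  have hp' : (0 : ℝ) < p := by exact_mod_cast hp
  have hq' : (0 : ℝ) < q := by exact_mod_cast hq
  have h1 : 4 * (p : ℝ) ^ (n + 1) ≤ (q : ℝ) ^ m := by exact_mod_cast h.large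
  have h2 : (p : ℝ) ^ ((n : ℤ) + 1) = (p : ℝ) ^ (n + 1) := by
    rw [← zpow_natCast]; push_cast; rfl
  rw [h2, zpow_natCast, ← one_div ((p : ℝ) ^ (n + 1)), le_div_iff₀ (by positivity), mul_assoc,
    ← div_eq_inv_mul, mul_div_assoc', div_le_one (by positivity)]
  exact h1

theorem pivot_bounds (h : IsNearGrid p q n β m k) (hp : 2 ≤ p) (hq : 2 ≤ q) :
    ((p : ℝ) ^ ((n : ℤ) + 1))⁻¹ ≤ pivot q m k - 2 * ((q : ℝ) ^ (m : ℤ))⁻¹ ∧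
      pivot q m k + ((q : ℝ) ^ (m : ℤ))⁻¹ ≤ ((p : ℝ) ^ ((n : ℤ) - 1))⁻¹ := by
  have hp' : (2 : ℝ) ≤ p := by exact_mod_cast hp
  have hq' : (2 : ℝ) ≤ q := by exact_mod_cast hq
  have h4 := h.four_mul_le (by omega) (by omega)
  have hY := h.inv_eq (by omega) (by omega)
  set ε := ((p : ℝ) ^ ((n : ℤ) + 1))⁻¹ with hε
  have hε0 : 0 < ε := by positivity
  set η := ((q : ℝ) ^ (m : ℤ))⁻¹ with hη
  have hη0 : 0 < η := by positivity
  have e1 : ((1 : ℤ) : ℝ) / (p : ℝ) ^ n = p * ε := by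
    rw [hε, zpow_add_one₀ (by positivity), zpow_natCast]; push_cast; field_simp
  have e2 : ((p : ℝ) ^ ((n : ℤ) - 1))⁻¹ = p * (p * ε) := by
    rw [← e1, zpow_sub_one₀ (by positivity), zpow_natCast]; push_cast; field_simp
  set δ := 1 / ((p : ℝ) ^ n * (q : ℝ) ^ (m + 1)) with hδ
  have hδ0 : 0 < δ := by positivity
  have e3 : δ ≤ η / 2 := by
    have hpn : (1 : ℝ) ≤ (p : ℝ) ^ n := one_le_pow₀ (by linarith)
    rw [hδ, hη, zpow_natCast, pow_succ, ← one_div, div_div]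
    apply one_div_le_one_div_of_le (by positivity)
    have hqm : 0 < (q : ℝ) ^ m := by positivity
    calc (q : ℝ) ^ m * 2 ≤ 1 * ((q : ℝ) ^ m * q) := by rw [one_mul]; gcongr
      _ ≤ _ := by gcongr
  rw [e1] at hY
  rw [e2]
  have h2 : 2 * ε ≤ p * ε := by gcongr
  have h3 : 2 * (p * ε) ≤ p * (p * ε) := by gcongr
  constructor
  · linarith
  · linarith

theorem subset_Ico (h : IsNearGrid p q n β m k) (hp : 2 ≤ p) (hq : 2 ≤ q) :
    adicInterval q m k ⊆ Ico ((p : ℝ) ^ ((n : ℤ) + 1))⁻¹ ((p : ℝ) ^ ((n : ℤ) - 1))⁻¹ := by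
  obtain ⟨h1, h2⟩ := h.pivot_bounds hp hq
  have hq' : (2 : ℝ) ≤ q := by exact_mod_cast hq
  have hη0 : 0 < ((q : ℝ) ^ (m : ℤ))⁻¹ := by positivity
  have e : pivot q m k = (k : ℝ) / (q : ℝ) ^ (m : ℤ) + (q - 1) / q * ((q : ℝ) ^ (m : ℤ))⁻¹ := by
    rw [pivot, zpow_add_one₀ (by positivity)]; push_cast; field_simp
  have h3 : (q - 1) / (q : ℝ) ≤ 1 := (div_le_one (by positivity)).2 (by linarith)
  have h4 : 0 ≤ (q - 1) / (q : ℝ) := div_nonneg (by linarith) (by positivity)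
  rw [adicInterval_eq_Ico]
  push_cast
  apply Ico_subset_Ico
  · nlinarith
  · nlinarith

end IsNearGrid

section

variable {p q : ℕ} {a b : ℝ} {n m k : ℕ → ℕ}

/-- The `α`-th flanks of the blocks show that the doubling condition fails. -/
theorem not_isDoublingOn (h : IsWeightPair q a b)
    (hdisj : Pairwise fun l l' => Disjoint (adicInterval q (m l) (k l))
      (adicInterval q (m l') (k l')))
    (hroom : ∀ l, Ico (pivot q (m l) (k l) - 2 * ((q : ℝ) ^ (m l : ℤ))⁻¹)
      (pivot q (m l) (k l) + ((q : ℝ) ^ (m l : ℤ))⁻¹) ⊆ Ico 0 1) :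
    ¬ IsDoublingOn (Ico 0 1)
      (reweightedMeasure q a b (fun l => m l) (fun l => k l) fun l => l + 1) := by
  rintro ⟨C, hC⟩
  have ha := h.pos
  have hb := h.b_pos
  have hq2 : (2 : ℝ) ≤ q := by exact_mod_cast h.two_le
  obtain ⟨l, hl⟩ := pow_unbounded_of_one_lt (C * q / a) ((one_lt_div ha).2 h.lt)
  set μ := reweightedMeasure q a b (fun l => (m l : ℤ)) (fun l => (k l : ℤ)) fun l => l + 1
  set Z := pivot q (m l) (k l) with hZ
  set η := ((q : ℝ) ^ ((m l : ℤ) + l + 1))⁻¹ with hη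
  have hη0 : 0 < η := by positivity
  have hηm : η ≤ ((q : ℝ) ^ (m l : ℤ))⁻¹ := (inv_zpow_scale_le_iff h.two_le).2 (by omega)
  have hη' : ((q : ℝ) ^ ((m l : ℤ) + (l + 1 : ℕ) + 1))⁻¹ = η / q := by
    rw [hη, show (m l : ℤ) + (l + 1 : ℕ) + 1 = m l + l + 1 + 1 by push_cast; ring,
      zpow_add_one₀ (by positivity)]
    field_simp
  have hηq : η / q ≤ η / 2 := by gcongr
  have e1 := hC (Z - η / 2) (η / 2) (by positivity) (by
    refine Subset.trans (Ico_subset_Ico ?_ ?_) (hroom l) <;> linarith)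
  have e2 : Ico (Z - η / 2 - η / 2) (Z - η / 2 + η / 2) = flankSet q (m l) (k l) false l := by
    rw [flankSet_false h.q_pos]; congr 1 <;> ring
  have e3 : flankSet q (m l) (k l) true (l + 1) ⊆
      Ico (Z - η / 2 - 2 * (η / 2)) (Z - η / 2 + 2 * (η / 2)) := by
    rw [flankSet_true h.q_pos, hη']
    exact Ico_subset_Ico (by linarith) (by linarith)
  obtain ⟨x, hx⟩ := nonempty_flankSet (q := q) (m := m l) (k := k l) (σ := false) (i := l) h.q_pos
  obtain ⟨y, hy⟩ := nonempty_flankSet (q := q) (m := m l) (k := k l) (σ := true) (i := l + 1)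
    h.q_pos
  have e4 := (measure_mono (μ := μ) e3).trans e1
  have mass := fun j σ x => reweightedMeasure_flankSet (m := fun l => (m l : ℤ))
    (k := fun l => (k l : ℤ)) (α := fun l => l + 1) h hdisj l j (σ := σ) (x := x)
  rw [e2, mass _ _ _ hx, mass _ _ _ hy,
    min_eq_left (by omega), min_eq_left (by omega), IsWeightPair.partialDensity_middle h.two_le hx,
    IsWeightPair.partialDensity_middle_succ h.two_le hy, hη', ← ENNReal.ofReal_coe_nnreal,
    ← ENNReal.ofReal_mul (by positivity),
    ENNReal.ofReal_le_ofReal_iff (by simp; positivity)] at e4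
  simp only [Bool.false_eq_true, if_false] at e4
  rw [div_lt_iff₀ ha, div_pow, div_mul_eq_mul_div, lt_div_iff₀ (by positivity)] at hl
  have e5 : b ^ (l + 1) * a ≤ C * q * a ^ (l + 1) := by
    have : b ^ (l + 1) * a * (η / q) = b ^ (l + 1) * a / q * η := by ring
    rw [this, ← mul_assoc] at e4
    have e6 := le_of_mul_le_mul_right e4 hη0
    rw [div_le_iff₀ (by positivity)] at e6
    linarith
  rw [pow_succ b, pow_succ a] at e5
  have hbl : 0 < b ^ l := by positivity
  nlinarith [mul_pos hbl ha, h.lt, mul_nonneg (mul_nonneg C.2 (by positivity : (0 : ℝ) ≤ q))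
    (by positivity : 0 ≤ a ^ l), h.lt_one, h.one_lt]

theorem infinite_reweightedFamily {m k : ℕ → ℤ} {α : ℕ → ℕ} (hq : 2 ≤ q)
    (hdisj : Pairwise fun l l' => Disjoint (adicInterval q (m l) (k l))
      (adicInterval q (m l') (k l'))) : (reweightedFamily q m k α).Infinite := by
  have hq' : (2 : ℝ) ≤ q := by exact_mod_cast hq
  have weights : ∀ b ∈ Ioo (1 : ℝ) q, IsWeightPair q ((q - b) / (q - 1)) b := fun b hb =>
    { two_le := hq
      pos := div_pos (by linarith [hb.2]) (by linarith)
      lt_one := (div_lt_one (by linarith)).2 (by linarith [hb.1])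
      one_lt := hb.1
      sum_eq := by
        rw [mul_div_cancel₀ _ (by linarith : (q : ℝ) - 1 ≠ 0)]
        ring }
  refine Set.infinite_of_injOn_mapsTo
    (f := fun b : ℝ => reweightedMeasure q ((q - b) / (q - 1)) b m k α) (s := Ioo (1 : ℝ) q) ?_ ?_
    (Ioo_infinite (by linarith))
  · intro b hb b' hb' heq
    obtain ⟨x, hx⟩ := nonempty_flankSet (q := q) (m := m 0) (k := k 0) (σ := true) (i := 0)
      (by omega)
    have hη : 0 < ((q : ℝ) ^ (m 0 + (0 : ℕ) + 1))⁻¹ := by positivity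
    have key : ∀ c ∈ Ioo (1 : ℝ) q,
        reweightedMeasure q ((q - c) / (q - 1)) c m k α (flankSet q (m 0) (k 0) true 0) =
          ENNReal.ofReal (c * ((q : ℝ) ^ (m 0 + (0 : ℕ) + 1))⁻¹) := fun c hc => by
      rw [reweightedMeasure_flankSet (weights c hc) hdisj 0 0 hx, zero_min,
        partialDensity_of_mem_flankSet hq hx]
      simp
    have h1 := key b hb
    simp only at heq
    rw [heq, key b' hb', ENNReal.ofReal_eq_ofReal_iff
      (mul_nonneg (by linarith [hb'.1]) hη.le) (mul_nonneg (by linarith [hb.1]) hη.le)] at h1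
    exact (mul_right_cancel₀ hη.ne' h1).symm
  · intro b hb
    have h := weights b hb
    exact ⟨_, b, h.pos, h.lt_one, h.one_lt, h.sum_eq, rfl⟩

end

theorem theorem1p1 (p q : ℕ) (hp : p.Prime) (hq : q.Prime) (hqp : q < p) :
    ∃ (m k : ℕ → ℤ) (α : ℕ → ℕ), IsSelection q m k α ∧
      (reweightedFamily q m k α).Infinite ∧
      ∀ μ ∈ reweightedFamily q m k α,
        μ (Ico 0 1) = 1 ∧
        IsAdicDoublingOn univ p μ ∧
        IsAdicDoublingOn univ q μ ∧
        ¬ IsDoublingOn (Ico 0 1) μ := by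
  have hq2 := hq.two_le
  have hp2 := hp.two_le
  have hp0 : (0 : ℝ) < p := by exact_mod_cast hp.pos
  set n : ℕ → ℕ := fun l => (q - 1) * (2 * l + 8) with hn
  have hq1 : 1 ≤ q - 1 := by omega
  have hn8 : ∀ l, 2 * l + 8 ≤ n l := fun l => Nat.le_mul_of_pos_left _ hq1
  have hsep' : ∀ l l', l < l' → n l + 2 ≤ n l' := fun l l' hl => by
    calc n l + 2 ≤ n l + (q - 1) * 2 := by omega
      _ = (q - 1) * (2 * (l + 1) + 8) := by simp only [hn]; ring
      _ ≤ n l' := Nat.mul_le_mul_left _ (by omega)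
  have hsep : ∀ l l', l ≠ l' → (n l : ℤ) + 2 ≤ n l' ∨ (n l' : ℤ) + 2 ≤ n l := fun l l' hl => by
    rcases Nat.lt_or_gt_of_ne hl with h | h
    · left; exact_mod_cast hsep' l l' h
    · right; exact_mod_cast hsep' l' l h
  choose m k hmk using fun l => exists_isNearGrid (β := l) hp hq hqp
    (show q - 1 ∣ n l from dvd_mul_right _ _) (hn8 l)
  have hI := fun l => (hmk l).subset_Ico hp2 hq2
  have hle_one : ∀ l, ((p : ℝ) ^ ((n l : ℤ) - 1))⁻¹ ≤ 1 := fun l => by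
    apply inv_le_one_of_one_le₀
    exact one_le_zpow₀ (by exact_mod_cast hp.one_le) (by have := hn8 l; omega)
  have hunit : ∀ l, Ico ((p : ℝ) ^ ((n l : ℤ) + 1))⁻¹ ((p : ℝ) ^ ((n l : ℤ) - 1))⁻¹ ⊆ Ico 0 1 :=
    fun l => Ico_subset_Ico (by positivity) (hle_one l)
  have hdisj : Pairwise fun l l' =>
      Disjoint (adicInterval q (m l) (k l)) (adicInterval q (m l') (k l')) := by
    have aux : ∀ l l', l < l' →
        Disjoint (adicInterval q (m l) (k l)) (adicInterval q (m l') (k l')) := fun l l' hl => by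
      refine Set.disjoint_left.2 fun x hx hx' => ?_
      refine absurd ((hI l' hx').2.trans_le ?_) (not_lt.2 (hI l hx).1)
      rw [inv_zpow_scale_le_iff hp2]
      have := hsep' l l' hl
      omega
    intro l l' hl
    rcases Nat.lt_or_gt_of_ne hl with h | h
    · exact aux l l' h
    · exact (aux l' l h).symm
  refine ⟨fun l => m l, fun l => k l, fun l => l + 1,
    ⟨fun l => (hI l).trans (hunit l), hdisj, fun l => by simp, fun c => ?_⟩,
    infinite_reweightedFamily hq2 hdisj, ?_⟩
  · exact (Set.finite_le_nat c).subset fun l hl => by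
      have : l + 1 = c := hl
      show l ≤ c
      omega
  rintro μ ⟨a, b, ha, ha1, hb1, hab, rfl⟩
  have h : IsWeightPair q a b := ⟨hq2, ha, ha1, hb1, hab⟩
  have transfer := fun l₀ (K : Set ℝ) hK hKl =>
    reweightedMeasure_eq_blockMeasure (α := fun l => l + 1) h hdisj l₀ (K := K) hK hKl
  refine ⟨?_, ?_, ?_, ?_⟩
  · rw [transfer 0 _ measurableSet_Ico fun l _ => Or.inl ((hI l).trans (hunit l))]
    have e : Ico (0 : ℝ) 1 = adicInterval q 0 0 := by simp [adicInterval]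
    rw [e, h.blockMeasure_adicInterval_of_le (by positivity), volume_adicInterval]
    simp
  · refine isAdicDoublingOn_univ_of_exists_mass (C := blockConst p q a b)
      (by linarith [(h.blockConst_ge p).2.2]) fun N j => ?_
    obtain ⟨l₀, hl₀⟩ := exists_uncut_adicChild (m := fun l => (m l : ℤ)) (k := fun l => (k l : ℤ))
      hp2 hsep hI N j
    have h4 := (hmk l₀).four_mul_le hp.pos hq.pos
    have hle : ((p : ℝ) ^ ((n l₀ : ℤ) + 1))⁻¹ ≤ ((p : ℝ) ^ n l₀)⁻¹ := by
      rw [← zpow_natCast, inv_zpow_scale_le_iff hp2]; omega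
    have hηpos : 0 < ((q : ℝ) ^ (m l₀ : ℤ))⁻¹ := by have := hq.pos; positivity
    obtain ⟨M, hM, hM'⟩ := h.exists_mass_adicChild (β := l₀) hp2
      (by have := hq.pos; positivity) ((hmk l₀).inv_eq hp.pos hq.pos)
      ((hmk l₀).offset_le hp.pos hq.pos) (by linarith) N j
    refine ⟨M, hM, fun i hi => ?_⟩
    rw [transfer l₀ (adicChild p N j i) measurableSet_adicInterval fun l hl => hl₀ l hl i hi]
    exact hM' i hi
  · refine isAdicDoublingOn_univ_of_exists_mass (C := b / a)
      (by linarith [h.one_le_ratio]) fun N j => ?_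
    obtain ⟨l₀, hl₀⟩ := exists_uncut_adicChild_self hq2 hdisj N j
    obtain ⟨M, hM, hM'⟩ := h.exists_mass_adicChild_self (m l₀) (k l₀) (l₀ + 1) N j
    refine ⟨M, hM, fun i hi => ?_⟩
    rw [transfer l₀ (adicChild q N j i) measurableSet_adicInterval fun l hl => hl₀ l hl i hi]
    exact hM' i hi
  · refine not_isDoublingOn h hdisj fun l => ?_
    obtain ⟨h1, h2⟩ := (hmk l).pivot_bounds hp2 hq2
    exact (Ico_subset_Ico h1 h2).trans (hunit l)
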